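/- Let $n,k\ge 0$ be integers and $\mathcal S\subset\{1,\dots,n\}$. Let $V=V(n,k)$ be the set of $k$-element subsets of $\{0,\dots,n\}$, let $P=\mathbb F_2[U_1,\dots,U_n]$, and for $\mathbf x,\mathbf y\in V$, $1\le i\le n$, put $|v|_i(\mathbf x,\mathbf y)=\bigl|\,|\mathbf y\cap\{i,\dots,n\}|-|\mathbf x\cap\{i,\dots,n\}|\,\bigr|$. Products of paths are written from left to right. **The algebra $\mathcal B(n,k,\mathcal S)$.** Let $\mathcal B_0(n,k)$ be the path algebra over $P$ of the complete directed graph on $V$ (one edge $f_{\mathbf x,\mathbf y}$ from $\mathbf x$ to $\mathbf y$ for each $(\mathbf x,\mathbf y)\in V^2$), modulo the two-sided ideal generated by $f_{\mathbf x,\mathbf x}-\mathbf I_{\mathbf x}$ and $$f_{\mathbf x,\mathbf y}f_{\mathbf y,\mathbf z}-\prod_{i=1}^nU_i^{(|v|_i(\mathbf y,\mathbf z)-|v|_i(\mathbf x,\mathbf z)+|v|_i(\mathbf x,\mathbf y))/2}f_{\mathbf x,\mathbf z}.$$ In it let $R_i$ be the sum of the $f_{\mathbf x,\mathbf y}$ with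 $i-1\in\mathbf x$, $i\notin\mathbf x$, $\mathbf y=(\mathbf x\setminus\{i-1\})\cup\{i\}$; let $L_i$ be the sum of the $f_{\mathbf x,\mathbf y}$ with $i\in\mathbf x$, $i-1\notin\mathbf x$, $\mathbf y=(\mathbf x\setminus\{i\})\cup\{i-1\}$; and let $U_i=\sum_{\mathbf x}U_if_{\mathbf x,\mathbf x}$. Let $\mathcal B(n,k)$ be the quotient of $\mathcal B_0(n,k)$ by the two-sided ideal generated by $R_iR_{i+1}$ and $L_{i+1}L_i$ ($1\le i\le n-1$) and by $\mathbf I_{\mathbf x}U_i$ for $\mathbf x\cap\{i-1,i\}=\varnothing$. Let $\mathcal B(n,k,\mathcal S)$ be the tensor product of $\mathcal B(n,k)$ with an exterior algebra on variables $C_i$, $i\in\mathcal S$, with the differential $\partial$ that satisfies the Leibniz rule, vanishes on $\mathcal B(n,k)$ and has $\partial C_i=U_i$. An additive generator $a=C_{i_1}\cdots C_{i_l}U_1^{r_1}\cdots U_n^{r_n}f_{\mathbf x,\mathbf y}$ has Alexander multi-degree $w(a)\in(\frac12\mathbb Z)^n$ with $w_i(a)=\#\{j:i_j=i\}+r_i+\frac12|v|_i(\mathbf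 x,\mathbf y)$ and Maslov degree $\mathfrak m(a)=l-2\sum_{i\in\mathcal S}w_i(a)\in\mathbb Z$. **The quiver algebra.** Let $\Gamma(n,k,\mathcal S)$ be the quiver with vertex set $V$ and arrows: an arrow labeled $R_i$ from $\mathbf x$ to $(\mathbf x\setminus\{i-1\})\cup\{i\}$ if $i-1\in\mathbf x$, $i\notin\mathbf x$; an arrow labeled $L_i$ from $\mathbf x$ to $(\mathbf x\setminus\{i\})\cup\{i-1\}$ if $i\in\mathbf x$, $i-1\notin\mathbf x$; at every vertex a loop labeled $U_i$ for each $1\le i\le n$ and a loop labeled $C_i$ for each $i\in\mathcal S$. Let $\mathcal Q$ be its path algebra over $\mathbb F_2$ modulo the two-sided ideal generated by the following relations, each imposed for all paths in $\Gamma(n,k,\mathcal S)$ with the given labels: 1. $R_iU_j=U_jR_i$, $L_iU_j=U_jL_i$, $U_iU_j=U_jU_i$; 2. $R_iL_i=U_i$, $L_iR_i=U_i$; 3. $R_iR_j=R_jR_i$, $L_iL_j=L_jL_i$, $R_iL_j=L_jR_i$ for $|i-j|>1$; 4. $R_iR_{i+1}=0$, $L_{i+1}L_i=0$; 5. $U_i=0$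 at each vertex $\mathbf x$ with $\mathbf x\cap\{i-1,i\}=\varnothing$; 6. $C_i^2=0$, and $C_iA=AC_i$ for every label $A$. Its differential satisfies the Leibniz rule, sends the $C_i$-loop at $\mathbf x$ to the $U_i$-loop at $\mathbf x$, and vanishes on all other arrows and on the idempotents. The degree of a path is the sum of the degrees of its arrows: $R_i$ and $L_i$ have $w=\frac12e_i$, and $U_i$ and $C_i$ have $w=e_i$; the Maslov degree is $0$ for $R_i,L_i,U_i$ with $i\notin\mathcal S$, is $-1$ for $R_i,L_i,C_i$ with $i\in\mathcal S$, and is $-2$ for $U_i$ with $i\in\mathcal S$. On both sides the single Alexander degree is $-\sum_{i\in\mathcal S}w_i+\sum_{i\notin\mathcal S}w_i$. **Theorem.** With these structures, the evident structure maps from $P^V$ (on $\mathcal Q$, the element $U_i\in P$ goes to the sum of all $U_i$-loops) and the Maslov grading together with either the Alexander multi-grading or the single Alexander grading, $\mathcal B(n,k,\mathcal S)$ and $\mathcal Q$ are dg algebras over $P^V$: they are the direct sums of their homogeneous parts (as $\mathbb F_2$-vector spaces), the product is additive on degrees, and $\partial$ is $P^V$-linear, satisfies $\partial^2=0$ and the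 Leibniz rule, lowers the Maslov degree by one and preserves the Alexander degree. In the same way $\mathcal Q$ is a dg algebra for the Maslov grading together with the unrefined multi-grading by $\mathbb Z^{2n}$, where, with basis $\tau_i,\beta_i$, the labels $R_i$, $L_i$, $U_i$, $C_i$ have degrees $\tau_i$, $\beta_i$, $\tau_i+\beta_i$, $\tau_i+\beta_i$. There is a ring isomorphism $F:\mathcal Q\to\mathcal B(n,k,\mathcal S)$ that is compatible with the structure maps from $P^V$, commutes with the differentials, and carries each homogeneous part of $\mathcal Q$ onto the homogeneous part of $\mathcal B(n,k,\mathcal S)$ of the same degree, both for the Maslov and Alexander multi-degree and for the Maslov and single Alexander degree. It sends an arrow $\mathbf x\to\mathbf y$ labeled $R_i$ or $L_i$ to $f_{\mathbf x,\mathbf y}$, the $U_i$-loop at $\mathbf x$ to $U_i\mathbf I_{\mathbf x}$, and the $C_i$-loop at $\mathbf x$ to $C_i\mathbf I_{\mathbf x}$. -/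

import Mathlib

namespace OSz

noncomputable section

/-! ## Path algebras of quivers, and quiver algebras with relations -/

/-- All paths of a quiver, each together with its start and its end. -/
abbrev AnyPath (V : Type) [Quiver V] : Type := Σ x y : V, Quiver.Path x y

/-- The path algebra with coefficients in `K`: the free `K`-module on the paths. -/
def PathAlg (K V : Type) [CommRing K] [Quiver V] : Type := AnyPath V →₀ K

namespace PathAlg

variable {K V : Type} [CommRing K] [Quiver V]

instance : AddCommGroup (PathAlg K V) := inferInstanceAs (AddCommGroup (AnyPath V →₀ K))
instance : Module K (PathAlg K V) := inferInstanceAs (Module K (AnyPath V →₀ K))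

/-- The basis element of the path algebra given by a path `x → y`. -/
def ofPath {x y : V} (p : Quiver.Path x y) : PathAlg K V :=
  Finsupp.single (⟨x, y, p⟩ : AnyPath V) (1 : K)

/-- The linear map on the path algebra with prescribed values on paths. -/
def lin {M : Type} [AddCommGroup M] [Module K M] (φ : AnyPath V → M) : PathAlg K V →ₗ[K] M :=
  Finsupp.linearCombination K φ

@[simp] theorem lin_ofPath {M : Type} [AddCommGroup M] [Module K M] (φ : AnyPath V → M)
    {x y : V} (p : Quiver.Path x y) : lin φ (ofPath p : PathAlg K V) = φ ⟨x, y, p⟩ := by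
  have h := Finsupp.linearCombination_single K (v := φ) (1 : K) (⟨x, y, p⟩ : AnyPath V)
  exact h.trans (one_smul K _)

theorem induction_on {P : PathAlg K V → Prop} (a : PathAlg K V) (zero : P 0)
    (add : ∀ a b, P a → P b → P (a + b)) (smul : ∀ (c : K) a, P a → P (c • a))
    (path : ∀ {x y : V} (p : Quiver.Path x y), P (ofPath p)) : P a := by
  refine Finsupp.induction_linear (motive := P) a zero (fun f g hf hg => add f g hf hg) ?_
  rintro ⟨x, y, p⟩ c
  have h := smul c _ (path p)
  have e : c • (ofPath p : PathAlg K V) = Finsupp.single (⟨x, y, p⟩ : AnyPath V) c :=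
    (Finsupp.smul_single_one _ c)
  exact e ▸ h

section Mul

variable [DecidableEq V]

/-- The product of two paths: their concatenation (first `p`, then `q`) if `p` ends where `q`
starts, and zero otherwise. -/
def concat (p q : AnyPath V) : PathAlg K V :=
  if h : q.1 = p.2.1 then ofPath (p.2.2.comp (q.2.2.cast h rfl)) else 0

/-- The bilinear extension of the concatenation of paths. -/
def mulLin : PathAlg K V →ₗ[K] PathAlg K V →ₗ[K] PathAlg K V :=
  lin fun p => lin fun q => concat p q

instance : Mul (PathAlg K V) := ⟨fun a b => mulLin a b⟩

theorem mul_def (a b : PathAlg K V) : a * b = mulLin a b := rfl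

theorem ofPath_mul_ofPath {x y z : V} (p : Quiver.Path x y) (q : Quiver.Path y z) :
    (ofPath p * ofPath q : PathAlg K V) = ofPath (p.comp q) := by
  simp [mul_def, mulLin, concat]

theorem ofPath_mul_of_ne {x y y' z : V} (h : y' ≠ y) (p : Quiver.Path x y)
    (q : Quiver.Path y' z) : (ofPath p * ofPath q : PathAlg K V) = 0 := by
  simp [mul_def, mulLin, concat, h]

/-- The distinguished idempotent `I_x`, the path of length zero at `x`. -/
def idem (x : V) : PathAlg K V := ofPath (Quiver.Path.nil : Quiver.Path x x)

theorem mul_add' (a b c : PathAlg K V) : a * (b + c) = a * b + a * c := by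
  simp [mul_def]

theorem add_mul' (a b c : PathAlg K V) : (a + b) * c = a * c + b * c := by
  simp [mul_def]

theorem smul_mul' (r : K) (a b : PathAlg K V) : (r • a) * b = r • (a * b) := by
  simp [mul_def]

theorem mul_smul' (r : K) (a b : PathAlg K V) : a * (r • b) = r • (a * b) := by
  simp [mul_def]

theorem zero_mul' (a : PathAlg K V) : 0 * a = 0 := by simp [mul_def]

theorem mul_zero' (a : PathAlg K V) : a * 0 = 0 := by simp [mul_def]

theorem mul_assoc' (a b c : PathAlg K V) : a * b * c = a * (b * c) := by
  induction a using induction_on with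
  | zero => simp [zero_mul']
  | add a a' h h' => simp [add_mul', h, h']
  | smul r a h => simp [smul_mul', h]
  | path p =>
    induction b using induction_on with
    | zero => simp [zero_mul', mul_zero']
    | add b b' h h' => simp [add_mul', mul_add', h, h']
    | smul r b h => simp [smul_mul', mul_smul', h]
    | path q =>
      induction c using induction_on with
      | zero => simp [mul_zero']
      | add c c' h h' => simp [mul_add', h, h']
      | smul r c h => simp [mul_smul', h]
      | @path u v s =>
        rename_i x y y' z
        by_cases h : y' = y
        · subst h
          by_cases h' : u = z
          · subst h'
            simp [ofPath_mul_ofPath, Quiver.Path.comp_assoc]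
          · simp [ofPath_mul_ofPath, ofPath_mul_of_ne h', mul_zero']
        · by_cases h' : u = z
          · subst h'
            simp [ofPath_mul_ofPath, ofPath_mul_of_ne h, zero_mul']
          · simp [ofPath_mul_of_ne h, ofPath_mul_of_ne h', mul_zero', zero_mul']

theorem sum_mul' {ι : Type} (s : Finset ι) (f : ι → PathAlg K V) (b : PathAlg K V) :
    (∑ i ∈ s, f i) * b = ∑ i ∈ s, f i * b := by
  simp [mul_def, map_sum, LinearMap.sum_apply]

theorem mul_sum' {ι : Type} (s : Finset ι) (f : ι → PathAlg K V) (b : PathAlg K V) :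
    b * (∑ i ∈ s, f i) = ∑ i ∈ s, b * f i := by
  simp [mul_def, map_sum]

theorem idem_mul_ofPath (w : V) {x y : V} (p : Quiver.Path x y) :
    (idem w * ofPath p : PathAlg K V) = if w = x then ofPath p else 0 := by
  split_ifs with h
  · subst h
    simp [idem, ofPath_mul_ofPath]
  · exact ofPath_mul_of_ne (Ne.symm h) _ _

theorem ofPath_mul_idem (w : V) {x y : V} (p : Quiver.Path x y) :
    (ofPath p * idem w : PathAlg K V) = if w = y then ofPath p else 0 := by
  split_ifs with h
  · subst h
    simp [idem, ofPath_mul_ofPath]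
  · exact ofPath_mul_of_ne h _ _

variable [Fintype V]

instance : One (PathAlg K V) := ⟨∑ x : V, idem x⟩

theorem one_mul' (a : PathAlg K V) : 1 * a = a := by
  induction a using induction_on with
  | zero => simp [mul_zero']
  | add b b' h h' => simp [mul_add', h, h']
  | smul r b h => simp [mul_smul', h]
  | path q =>
    show (∑ x : V, idem x) * ofPath q = ofPath q
    simp [sum_mul', idem_mul_ofPath]

theorem mul_one' (a : PathAlg K V) : a * 1 = a := by
  induction a using induction_on with
  | zero => simp [zero_mul']
  | add b b' h h' => simp [add_mul', h, h']
  | smul r b h => simp [smul_mul', h]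
  | path q =>
    show ofPath q * (∑ x : V, idem x) = ofPath q
    simp [mul_sum', ofPath_mul_idem]

instance : Ring (PathAlg K V) :=
  { (inferInstance : AddCommGroup (PathAlg K V)) with
    mul := (· * ·)
    one := 1
    left_distrib := mul_add'
    right_distrib := add_mul'
    zero_mul := zero_mul'
    mul_zero := mul_zero'
    mul_assoc := mul_assoc'
    one_mul := one_mul'
    mul_one := mul_one' }

instance : Algebra K (PathAlg K V) := Algebra.ofModule smul_mul' mul_smul'

theorem complete_idem : CompleteOrthogonalIdempotents (fun x : V => (idem x : PathAlg K V)) where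
  idem x := by
    show idem x * idem x = idem x
    simp [idem, ofPath_mul_ofPath]
  ortho x y h := ofPath_mul_of_ne (Ne.symm h) _ _
  complete := rfl

end Mul

end PathAlg

/-- The quiver algebra with relations: the quotient of the path algebra by the two-sided ideal
generated by the set `R` of relations. -/
abbrev QuivAlg (K V : Type) [CommRing K] [Quiver V] [DecidableEq V] [Fintype V]
    (R : Set (PathAlg K V)) : Type :=
  (TwoSidedIdeal.span R).ringCon.Quotient

/-- The quotient map from a ring to its quotient by the two-sided ideal generated by a set. -/
abbrev quotMap {A : Type} [Ring A] (R : Set A) : A →+* (TwoSidedIdeal.span R).ringCon.Quotient :=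
  (TwoSidedIdeal.span R).ringCon.mk'

/-- If `e` is a complete family of orthogonal idempotents in `A`, indexed by `V`, and `φ : K → A`
is a ring homomorphism with central image, then `A` is an algebra over `K^V`, through
`a ↦ ∑ x, φ (a x) e_x`. -/
def idemHom {K A V : Type} [CommRing K] [Ring A] [Fintype V] [DecidableEq V] (e : V → A)
    (he : CompleteOrthogonalIdempotents e) (φ : K →+* A) (hφ : ∀ c a, φ c * a = a * φ c) :
    (V → K) →+* A where
  toFun a := ∑ x, φ (a x) * e x
  map_one' := by simp [he.complete]
  map_zero' := by simp
  map_add' a b := by simp [add_mul, Finset.sum_add_distrib]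
  map_mul' a b := by
    rw [Finset.sum_mul_sum]
    refine Finset.sum_congr rfl fun x _ => ?_
    rw [Finset.sum_eq_single x]
    · have h : e x * e x = e x := he.idem x
      rw [Pi.mul_apply, map_mul, mul_assoc, mul_assoc, ← mul_assoc (e x), ← hφ (b x) (e x),
        mul_assoc, h]
    · intro y _ hy
      have h : e x * e y = 0 := he.ortho (Ne.symm hy)
      rw [mul_assoc, ← mul_assoc (e x), ← hφ (b y) (e x), mul_assoc, h, mul_zero, mul_zero]
    · simp

/-! ## Graded differential algebras -/

/-- `A`, with the structure map `η : 𝕀 → A` (not necessarily with central image), the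
map `∂` and the family `𝒜` of additive subgroups, is a differential graded algebra over `𝕀`,
with differential of degree `-lam`. No signs occur, as everything is in characteristic two. -/
structure IsDGAlgebra {𝕀 A G : Type} [CommRing 𝕀] [Ring A] [AddCommGroup G]
    (η : 𝕀 →+* A) (d : A →+ A) (𝒜 : G → AddSubgroup A) (lam : G) : Prop where
  map_smul_left : ∀ c a, d (η c * a) = η c * d a
  map_smul_right : ∀ c a, d (a * η c) = d a * η c
  sq_zero : ∀ a, d (d a) = 0
  leibniz : ∀ a b, d (a * b) = d a * b + a * d b
  one_mem : (1 : A) ∈ 𝒜 0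
  mul_mem : ∀ g h a b, a ∈ 𝒜 g → b ∈ 𝒜 h → a * b ∈ 𝒜 (g + h)
  internal : open Classical in DirectSum.IsInternal 𝒜
  d_mem : ∀ g a, a ∈ 𝒜 g → d a ∈ 𝒜 (g - lam)

/-- The group `½ℤ`. -/
abbrev HalfInt : Type := AddSubgroup.zmultiples (1 / 2 : ℚ)

/-- The element `m / 2` of `½ℤ`. -/
def halves (m : ℤ) : HalfInt := m • ⟨1 / 2, AddSubgroup.mem_zmultiples _⟩

/-! ## I-states

The lines `1, …, n` are indexed by `i : Fin n`; the element `i` stands for line `i + 1`, which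
separates the regions `i.castSucc` and `i.succ` among the regions `0, …, n`. -/

/-- The I-states: the subsets of `{0, …, n}` with `k` elements. -/
abbrev IState (n k : ℕ) : Type := {x : Finset (Fin (n + 1)) // x.card = k}

/-- `F₂[U_1, …, U_n]`. -/
abbrev Poly (n : ℕ) : Type := MvPolynomial (Fin n) (ZMod 2)

/-- The minimal relative weight vector: for line `i`, the difference of the numbers of elements
of `y` and of `x` beyond that line. -/
def relWeight {n k : ℕ} (x y : IState n k) (i : Fin n) : ℤ :=
  ((y.1.filter fun j => i.succ ≤ j).card : ℤ) - ((x.1.filter fun j => i.succ ≤ j).card : ℤ)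

/-- The minimal relative grading vector. -/
def absWeight {n k : ℕ} (x y : IState n k) (i : Fin n) : ℤ := |relWeight x y i|

/-- `y` arises from `x` by moving a dot from region `i.castSucc` to the free region `i.succ`. -/
def MovesRight {n k : ℕ} (i : Fin n) (x y : IState n k) : Prop :=
  i.castSucc ∈ x.1 ∧ i.succ ∉ x.1 ∧ y.1 = insert i.succ (x.1.erase i.castSucc)

/-- `y` arises from `x` by moving a dot from region `i.succ` to the free region `i.castSucc`. -/
def MovesLeft {n k : ℕ} (i : Fin n) (x y : IState n k) : Prop :=
  i.succ ∈ x.1 ∧ i.castSucc ∉ x.1 ∧ y.1 = insert i.castSucc (x.1.erase i.succ)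

/-! ## The algebra `B_0(n,k)` -/

/-- The vertices of the complete directed graph `K(n,k)`. -/
def KVert (n k : ℕ) : Type := IState n k

instance (n k : ℕ) : DecidableEq (KVert n k) := inferInstanceAs (DecidableEq (IState n k))
instance (n k : ℕ) : Fintype (KVert n k) := inferInstanceAs (Fintype (IState n k))

/-- One edge for each ordered pair of vertices. -/
instance (n k : ℕ) : Quiver (KVert n k) := ⟨fun _ _ => Unit⟩

/-- The edge `f_{x,y}` of `K(n,k)`, in the path algebra. -/
def kEdge {n k : ℕ} (x y : KVert n k) : PathAlg (Poly n) (KVert n k) :=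
  PathAlg.ofPath (x := x) (y := y) (Quiver.Hom.toPath (show x ⟶ y from ()))

/-- The monomial by which `f_{x,y} f_{y,z}` and `f_{x,z}` differ; the halved quantity is always
a nonnegative even integer. -/
def structMonomial {n k : ℕ} (x y z : IState n k) : Poly n :=
  ∏ i : Fin n, MvPolynomial.X i ^ ((absWeight y z i - absWeight x z i + absWeight x y i) / 2).toNat

/-- The relations of `B_0(n,k)`: `f_{x,x}` is the idempotent at `x`, and the product of `f_{x,y}`
and `f_{y,z}` is a monomial times `f_{x,z}`. -/
def kRel (n k : ℕ) : Set (PathAlg (Poly n) (KVert n k)) :=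
  {a | ∃ x : KVert n k, a = kEdge x x - PathAlg.idem x} ∪
  {a | ∃ x y z : KVert n k,
    a = kEdge x y * kEdge y z - structMonomial (k := k) x y z • kEdge x z}

/-- The algebra `B_0(n,k)`. -/
abbrev B0 (n k : ℕ) : Type := QuivAlg (Poly n) (KVert n k) (kRel n k)

namespace B0

/-- The element `f_{x,y}` of `B_0(n,k)`. -/
def f {n k : ℕ} (x y : IState n k) : B0 n k := quotMap (kRel n k) (kEdge x y)

/-- The idempotent `I_x` of `B_0(n,k)`. -/
def idem {n k : ℕ} (x : IState n k) : B0 n k :=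
  quotMap (kRel n k) (PathAlg.idem (V := KVert n k) x)

open Classical in
/-- The element `R_i`, the sum of all `f_{x,y}` for which `y` arises from `x` by moving a dot
rightwards across line `i`. -/
def R {n : ℕ} (k : ℕ) (i : Fin n) : B0 n k :=
  ∑ x : IState n k, ∑ y : IState n k, if MovesRight i x y then f x y else 0

open Classical in
/-- The element `L_i`. -/
def L {n : ℕ} (k : ℕ) (i : Fin n) : B0 n k :=
  ∑ x : IState n k, ∑ y : IState n k, if MovesLeft i x y then f x y else 0

/-- The element `U_i`. -/
def U {n : ℕ} (k : ℕ) (i : Fin n) : B0 n k :=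
  ∑ x : IState n k, (MvPolynomial.X i : Poly n) • f x x

end B0

/-! ## The algebra `B(n,k)` -/

/-- The elements of `B_0(n,k)` that vanish in `B(n,k)`: `R_i R_{i+1}`, `L_{i+1} L_i`, and
`I_x U_i` if the two regions next to line `i` are not in `x`. -/
def bRel (n k : ℕ) : Set (B0 n k) :=
  {a | ∃ i j : Fin n, j.val = i.val + 1 ∧ a = B0.R k i * B0.R k j} ∪
  {a | ∃ i j : Fin n, j.val = i.val + 1 ∧ a = B0.L k j * B0.L k i} ∪
  {a | ∃ (x : IState n k) (i : Fin n), i.castSucc ∉ x.1 ∧ i.succ ∉ x.1 ∧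
    a = B0.idem x * B0.U k i}

/-- The algebra `B(n,k)`. -/
abbrev B (n k : ℕ) : Type := (TwoSidedIdeal.span (bRel n k)).ringCon.Quotient

/-! ## The dg algebra `B(n,k,S)` -/

/-- The exterior algebra over `F₂[U_1, …, U_n]` on variables `C_i` for `i ∈ S`. -/
abbrev Ext {n : ℕ} (S : Finset (Fin n)) : Type := ExteriorAlgebra (Poly n) (S → Poly n)

/-- The variable `C_i` of the exterior algebra. -/
def extC {n : ℕ} {S : Finset (Fin n)} (i : S) : Ext S :=
  ExteriorAlgebra.ι (Poly n) (Pi.single i 1)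

/-- The linear form with `C_i ↦ U_i`. -/
def koszulForm {n : ℕ} (S : Finset (Fin n)) : Module.Dual (Poly n) (S → Poly n) :=
  ∑ i : S, (MvPolynomial.X i.1 : Poly n) • LinearMap.proj i

/-- The Koszul differential on the exterior algebra: the (anti)derivation with `C_i ↦ U_i`. -/
def extD {n : ℕ} (S : Finset (Fin n)) : Ext S →ₗ[Poly n] Ext S :=
  CliffordAlgebra.contractLeft (koszulForm S)

/-- The algebra `B(n,k,S)`, the tensor product of `B(n,k)` with an exterior algebra. -/
abbrev BS {n : ℕ} (k : ℕ) (S : Finset (Fin n)) : Type :=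
  TensorProduct (Poly n) (B n k) (Ext S)

namespace BS

variable {n : ℕ} (k : ℕ) (S : Finset (Fin n))

/-- The element `f_{x,y}` of `B(n,k,S)`. -/
def f {k : ℕ} (x y : IState n k) : BS k S :=
  Algebra.TensorProduct.includeLeftRingHom (quotMap (bRel n k) (B0.f x y))

/-- The element `C_i` of `B(n,k,S)`. -/
def C {S : Finset (Fin n)} (i : S) : BS k S := TensorProduct.tmul (Poly n) (1 : B n k) (extC i)

/-- The differential of `B(n,k,S)`, which vanishes on `B(n,k)` and sends `C_i` to `U_i`. -/
def d : BS k S →+ BS k S := (LinearMap.lTensor (B n k) (extD S)).toAddMonoidHom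

/-- The idempotent `I_x` of `B(n,k,S)`. -/
def idem {k : ℕ} (x : IState n k) : BS k S :=
  Algebra.TensorProduct.includeLeftRingHom (quotMap (bRel n k) (B0.idem x))

theorem complete_idem : CompleteOrthogonalIdempotents (fun x : IState n k => idem S x) :=
  (PathAlg.complete_idem (K := Poly n) (V := KVert n k)).map
    (((Algebra.TensorProduct.includeLeftRingHom : B n k →+* BS k S).comp
      (quotMap (bRel n k))).comp (quotMap (kRel n k)))

/-- `B(n,k,S)` as an algebra over `F₂[U_1, …, U_n]^{V(n,k)}`. -/
def structHom : (IState n k → Poly n) →+* BS k S :=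
  idemHom (fun x => idem S x) (complete_idem k S) (algebraMap (Poly n) (BS k S))
    (fun c a => Algebra.commutes c a)

/-- The additive generator `C_{i_1} ⋯ C_{i_l} U^r f_{x,y}`; it is zero if an index is repeated. -/
def gen {k : ℕ} (l : List S) (r : Fin n → ℕ) (x y : IState n k) : BS k S :=
  (l.map (C k)).prod * ((∏ i, MvPolynomial.X i ^ r i : Poly n) • f S x y)

/-- Twice the Alexander multi-degree of `C_{i_1} ⋯ C_{i_l} U^r f_{x,y}`, whose component at line
`i` is the number of indices `i_j` equal to `i`, plus `r_i`, plus half of `|v|_i(x,y)`. -/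
def genWeight {k : ℕ} (l : List S) (r : Fin n → ℕ) (x y : IState n k) (i : Fin n) : ℤ :=
  2 * ((l.map Subtype.val).count i : ℤ) + 2 * (r i : ℤ) + absWeight x y i

/-- The Maslov degree (number of `C`-factors minus twice the sum over `i ∈ S` of the components
of the multi-degree) and the Alexander multi-degree of an additive generator. -/
def genDeg {k : ℕ} (l : List S) (r : Fin n → ℕ) (x y : IState n k) : ℤ × (Fin n → HalfInt) :=
  ((l.length : ℤ) - ∑ i ∈ S, genWeight S l r x y i, fun i => halves (genWeight S l r x y i))

/-- The homogeneous parts of `B(n,k,S)` for the degree `σ ∘ genDeg`: the subgroup spanned by the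
additive generators of the given degree. -/
def part {G : Type} (σ : ℤ × (Fin n → HalfInt) → G) (g : G) : AddSubgroup (BS k S) :=
  AddSubgroup.closure {a | ∃ (l : List S) (r : Fin n → ℕ) (x y : IState n k),
    σ (genDeg S l r x y) = g ∧ a = gen S l r x y}

end BS

/-- The pair of the Maslov degree and the single Alexander degree obtained from the pair of the
Maslov degree and the Alexander multi-degree. -/
def collapse {n : ℕ} (S : Finset (Fin n)) (g : ℤ × (Fin n → HalfInt)) : ℤ × HalfInt :=
  (g.1, -∑ i ∈ S, g.2 i + ∑ i ∈ Sᶜ, g.2 i)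

/-! ## The quiver `Γ(n,k,S)` -/

/-- The labels of the arrows. -/
inductive Label {n : ℕ} (S : Finset (Fin n)) : Type
  | R (i : Fin n)
  | L (i : Fin n)
  | U (i : Fin n)
  | C (i : S)

/-- There is an arrow with the given label from `x` to `y`. -/
def Label.Joins {n : ℕ} {S : Finset (Fin n)} {k : ℕ} :
    Label S → IState n k → IState n k → Prop
  | .R i, x, y => MovesRight i x y
  | .L i, x, y => MovesLeft i x y
  | .U _, x, y => x = y
  | .C _, x, y => x = y

/-- The vertices of `Γ(n,k,S)`. -/
def GVert {n : ℕ} (k : ℕ) (_S : Finset (Fin n)) : Type := IState n k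

section Gamma

variable {n : ℕ} {k : ℕ} {S : Finset (Fin n)}

/-- The I-state that is a vertex of `Γ(n,k,S)`. -/
def GVert.state (x : GVert k S) : IState n k := x

instance : DecidableEq (GVert k S) := inferInstanceAs (DecidableEq (IState n k))
instance : Fintype (GVert k S) := inferInstanceAs (Fintype (IState n k))

/-- The arrows of `Γ(n,k,S)`. -/
instance : Quiver (GVert k S) := ⟨fun x y => {ℓ : Label S // ℓ.Joins x.state y.state}⟩

/-- The label of an arrow. -/
def arrowLabel {x y : GVert k S} (e : x ⟶ y) : Label S := Subtype.val e

/-- The word `μ(γ)` in the labels that is read off along a path. -/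
def word {x : GVert k S} : {y : GVert k S} → Quiver.Path x y → List (Label S)
  | _, .nil => []
  | _, .cons p e => word p ++ [arrowLabel e]

/-- The path of length one consisting of the `U_i`-loop at `x`. -/
def uLoop (i : Fin n) (x : GVert k S) : Quiver.Path x x :=
  Quiver.Hom.toPath (⟨Label.U i, rfl⟩ : x ⟶ x)

/-- The pairs of words that are identified in the quiver algebra. -/
inductive WordEq (S : Finset (Fin n)) : List (Label S) → List (Label S) → Prop
  | r_u (i j : Fin n) : WordEq S [.R i, .U j] [.U j, .R i]
  | l_u (i j : Fin n) : WordEq S [.L i, .U j] [.U j, .L i]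
  | u_u (i j : Fin n) : WordEq S [.U i, .U j] [.U j, .U i]
  | r_l (i : Fin n) : WordEq S [.R i, .L i] [.U i]
  | l_r (i : Fin n) : WordEq S [.L i, .R i] [.U i]
  | r_r (i j : Fin n) (h : 1 < |(i.val : ℤ) - j.val|) : WordEq S [.R i, .R j] [.R j, .R i]
  | l_l (i j : Fin n) (h : 1 < |(i.val : ℤ) - j.val|) : WordEq S [.L i, .L j] [.L j, .L i]
  | r_l_far (i j : Fin n) (h : 1 < |(i.val : ℤ) - j.val|) : WordEq S [.R i, .L j] [.L j, .R i]
  | c_central (i : S) (a : Label S) : WordEq S [.C i, a] [a, .C i]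

/-- The words all of whose paths are zero in the quiver algebra. -/
inductive WordZero (S : Finset (Fin n)) : List (Label S) → Prop
  | r_r (i j : Fin n) (h : j.val = i.val + 1) : WordZero S [.R i, .R j]
  | l_l (i j : Fin n) (h : j.val = i.val + 1) : WordZero S [.L j, .L i]
  | c_c (i : S) : WordZero S [.C i, .C i]

/-- The relations on `Γ(n,k,S)`; the last set holds the `U`-vanishing relations. -/
def gRel (k : ℕ) (S : Finset (Fin n)) : Set (PathAlg (ZMod 2) (GVert k S)) :=
  {a | ∃ (x y : GVert k S) (p q : Quiver.Path x y), WordEq S (word p) (word q) ∧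
    a = PathAlg.ofPath p - PathAlg.ofPath q} ∪
  {a | ∃ (x y : GVert k S) (p : Quiver.Path x y), WordZero S (word p) ∧ a = PathAlg.ofPath p} ∪
  {a | ∃ (x : GVert k S) (i : Fin n), i.castSucc ∉ x.state.1 ∧ i.succ ∉ x.state.1 ∧
    a = PathAlg.ofPath (uLoop i x)}

end Gamma

/-- The quiver algebra of `Γ(n,k,S)` over `F₂`, with the relations above. -/
abbrev GS {n : ℕ} (k : ℕ) (S : Finset (Fin n)) : Type :=
  QuivAlg (ZMod 2) (GVert k S) (gRel k S)

namespace GS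

variable {n : ℕ} {k : ℕ} {S : Finset (Fin n)}

/-- The class of a path. -/
def ofPath {x y : GVert k S} (p : Quiver.Path x y) : GS k S :=
  quotMap (gRel k S) (PathAlg.ofPath p)

/-- The class of an arrow. -/
def ofArrow {x y : GVert k S} (e : x ⟶ y) : GS k S := ofPath e.toPath

theorem quot_eq_of_sub_mem {a b : PathAlg (ZMod 2) (GVert k S)}
    (h : a - b ∈ TwoSidedIdeal.span (gRel k S)) : quotMap (gRel k S) a = quotMap (gRel k S) b :=
  (RingCon.eq _).2 ((TwoSidedIdeal.rel_iff _ _ _).2 h)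

theorem ofPath_eq {x y : GVert k S} {p q : Quiver.Path x y} (h : WordEq S (word p) (word q)) :
    ofPath p = ofPath q :=
  quot_eq_of_sub_mem (TwoSidedIdeal.subset_span (Or.inl (Or.inl ⟨x, y, p, q, h, rfl⟩)))

theorem ofPath_comp {x y z : GVert k S} (p : Quiver.Path x y) (q : Quiver.Path y z) :
    ofPath (p.comp q) = ofPath p * ofPath q := by
  unfold ofPath
  rw [← map_mul, PathAlg.ofPath_mul_ofPath]

theorem ofPath_mul_of_ne {x y y' z : GVert k S} (h : y' ≠ y) (p : Quiver.Path x y)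
    (q : Quiver.Path y' z) : ofPath p * ofPath q = 0 := by
  unfold ofPath
  rw [← map_mul, PathAlg.ofPath_mul_of_ne h, map_zero]

/-- The element `U_i` of the quiver algebra, the sum of all loops with label `U_i`. -/
def U (i : Fin n) : GS k S := ∑ x : GVert k S, ofPath (uLoop i x)

theorem uLoop_mul_arrow (i : Fin n) {x y : GVert k S} (e : x ⟶ y) :
    ofPath (uLoop i x) * ofPath e.toPath = ofPath e.toPath * ofPath (uLoop i y) := by
  rw [← ofPath_comp, ← ofPath_comp]
  obtain ⟨ℓ, h⟩ := e
  cases ℓ with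
  | R j => exact (ofPath_eq (S := S) (WordEq.r_u j i)).symm
  | L j => exact (ofPath_eq (S := S) (WordEq.l_u j i)).symm
  | U j => exact ofPath_eq (S := S) (WordEq.u_u i j)
  | C j => 
    symm
    exact ofPath_eq (S := S) (WordEq.c_central j (.U i))

theorem uLoop_mul_path (i : Fin n) {x y : GVert k S} (p : Quiver.Path x y) :
    ofPath (uLoop i x) * ofPath p = ofPath p * ofPath (uLoop i y) := by
  induction p with
  | nil => rw [← ofPath_comp, ← ofPath_comp, Quiver.Path.comp_nil, Quiver.Path.nil_comp]
  | cons p e ih =>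
    have h : p.cons e = p.comp e.toPath := rfl
    rw [h, ofPath_comp, ← mul_assoc, ih, mul_assoc, mul_assoc, uLoop_mul_arrow]

theorem U_comm (i : Fin n) (a : GS k S) : U i * a = a * U i := by
  obtain ⟨a, rfl⟩ : ∃ b, quotMap (gRel k S) b = a := RingCon.mk'_surjective _ a
  induction a using PathAlg.induction_on with
  | zero => simp
  | add a b ha hb => rw [map_add, mul_add, add_mul, ha, hb]
  | smul c a ha =>
    rw [Algebra.smul_def, map_mul, ← mul_assoc]
    have hc : U i * quotMap (gRel k S) (algebraMap _ _ c) =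
        quotMap (gRel k S) (algebraMap _ _ c) * U i :=
      (Algebra.commutes (A := GS k S) c (U i)).symm
    rw [hc, mul_assoc, ha, mul_assoc]
  | @path x y p =>
    show (∑ z, ofPath (uLoop i z)) * ofPath p = ofPath p * ∑ z, ofPath (uLoop i z)
    rw [Finset.sum_mul, Finset.mul_sum, Finset.sum_eq_single x, Finset.sum_eq_single y,
      uLoop_mul_path]
    · exact fun z _ hz => ofPath_mul_of_ne hz _ _
    · simp
    · exact fun z _ hz => ofPath_mul_of_ne (Ne.symm hz) _ _
    · simp

/-- The idempotent `I_x` of the quiver algebra. -/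
def idem (x : GVert k S) : GS k S := quotMap (gRel k S) (PathAlg.idem x)

/-- The map from `F₂[U_1, …, U_n]` to the center of the quiver algebra that sends `U_i` to the
sum of all loops with label `U_i`. -/
def polyHom (k : ℕ) (S : Finset (Fin n)) : Poly n →ₐ[ZMod 2] Subalgebra.center (ZMod 2) (GS k S) :=
  MvPolynomial.aeval fun i => ⟨U i, Subalgebra.mem_center_iff.2 fun b => (U_comm i b).symm⟩

/-- The quiver algebra as an algebra over `F₂[U_1, …, U_n]^{V(n,k)}`. -/
def structHom (k : ℕ) (S : Finset (Fin n)) : (IState n k → Poly n) →+* GS k S :=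
  idemHom (V := GVert k S) (fun x => idem x)
    ((PathAlg.complete_idem (K := ZMod 2) (V := GVert k S)).map (quotMap (gRel k S)))
    ((Subalgebra.center (ZMod 2) (GS k S)).val.toRingHom.comp (polyHom k S).toRingHom)
    (fun c a => (Subalgebra.mem_center_iff.1 (polyHom k S c).2 a).symm)

/-! ### The differential -/

/-- The differential of an arrow: the `U_i`-loop at `x` for the `C_i`-loop at `x`, and zero for
every other arrow. -/
def arrowD {x y : GVert k S} (e : x ⟶ y) : PathAlg (ZMod 2) (GVert k S) :=
  match e with
  | ⟨.C i, _⟩ => PathAlg.ofPath (uLoop i.1 x)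
  | _ => 0

/-- The differential of a path, by the Leibniz rule. -/
def pathD {x : GVert k S} : {y : GVert k S} → Quiver.Path x y → PathAlg (ZMod 2) (GVert k S)
  | _, .nil => 0
  | _, .cons p e => pathD p * PathAlg.ofPath e.toPath + PathAlg.ofPath p * arrowD e

/-- The differential of the path algebra. -/
def preD (k : ℕ) (S : Finset (Fin n)) :
    PathAlg (ZMod 2) (GVert k S) →ₗ[ZMod 2] PathAlg (ZMod 2) (GVert k S) :=
  PathAlg.lin fun p => pathD p.2.2

theorem idem_mul_arrowD {x y : GVert k S} (e : x ⟶ y) :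
    PathAlg.idem x * arrowD e = arrowD e := by
  obtain ⟨ℓ, h⟩ := e
  cases ℓ <;> simp [arrowD, PathAlg.idem_mul_ofPath]

theorem arrowD_mul_idem {x y : GVert k S} (e : x ⟶ y) :
    arrowD e * PathAlg.idem y = arrowD e := by
  obtain ⟨ℓ, h⟩ := e
  cases ℓ with
  | C i =>
    obtain rfl : x = y := h
    simp [arrowD, PathAlg.ofPath_mul_idem]
  | _ => simp [arrowD]

theorem idem_mul_pathD {x y : GVert k S} (p : Quiver.Path x y) :
    PathAlg.idem x * pathD p = pathD p := by
  induction p with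
  | nil => simp [pathD]
  | cons p e ih => rw [pathD, mul_add, ← mul_assoc, ← mul_assoc, ih, PathAlg.idem_mul_ofPath,
      if_pos rfl]

theorem pathD_mul_idem {x y : GVert k S} (p : Quiver.Path x y) :
    pathD p * PathAlg.idem y = pathD p := by
  cases p with
  | nil => simp [pathD]
  | cons p e => rw [pathD, add_mul, mul_assoc, mul_assoc, arrowD_mul_idem,
      PathAlg.ofPath_mul_idem, if_pos rfl]

theorem pathD_comp {x y z : GVert k S} (p : Quiver.Path x y) (q : Quiver.Path y z) :
    pathD (p.comp q) = pathD p * PathAlg.ofPath q + PathAlg.ofPath p * pathD q := by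
  induction q with
  | nil =>
    have h := pathD_mul_idem p
    rw [PathAlg.idem] at h
    rw [Quiver.Path.comp_nil, pathD, mul_zero, add_zero, h]
  | cons q e ih =>
    have h : (PathAlg.ofPath (q.cons e) : PathAlg (ZMod 2) (GVert k S)) =
        PathAlg.ofPath q * PathAlg.ofPath e.toPath := by
      rw [PathAlg.ofPath_mul_ofPath]
      rfl
    rw [Quiver.Path.comp_cons, pathD, pathD, ih, h, ← PathAlg.ofPath_mul_ofPath]
    noncomm_ring

theorem preD_mul (a b : PathAlg (ZMod 2) (GVert k S)) :
    preD k S (a * b) = preD k S a * b + a * preD k S b := by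
  induction a using PathAlg.induction_on with
  | zero => simp
  | add a a' h h' => simp only [add_mul, map_add, h, h']; abel
  | smul c a h => simp only [smul_mul_assoc, map_smul, h, smul_add]
  | path p =>
    induction b using PathAlg.induction_on with
    | zero => simp
    | add b b' h h' => simp only [mul_add, map_add, h, h']; abel
    | smul c b h => simp only [mul_smul_comm, map_smul, h, smul_add]
    | path q =>
      rename_i x y y' z
      by_cases h : y' = y
      · subst h
        rw [PathAlg.ofPath_mul_ofPath]
        simp only [preD, PathAlg.lin_ofPath, pathD_comp]
      · rw [PathAlg.ofPath_mul_of_ne h, map_zero]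
        simp only [preD, PathAlg.lin_ofPath]
        have h0 : (PathAlg.idem y * PathAlg.idem y' : PathAlg (ZMod 2) (GVert k S)) = 0 :=
          PathAlg.ofPath_mul_of_ne h _ _
        have hp : (PathAlg.ofPath p * PathAlg.idem y : PathAlg (ZMod 2) (GVert k S)) =
            PathAlg.ofPath p := by rw [PathAlg.ofPath_mul_idem, if_pos rfl]
        have hq : (PathAlg.idem y' * PathAlg.ofPath q : PathAlg (ZMod 2) (GVert k S)) =
            PathAlg.ofPath q := by rw [PathAlg.idem_mul_ofPath, if_pos rfl]
        rw [← pathD_mul_idem p, ← hq, mul_assoc, ← mul_assoc (PathAlg.idem y), h0, zero_mul,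
          mul_zero, zero_add, ← hp, ← idem_mul_pathD q, mul_assoc,
          ← mul_assoc (PathAlg.idem y), h0, zero_mul, mul_zero]

theorem add_self (a : GS k S) : a + a = 0 := by
  have h : ((1 + 1 : ZMod 2)) • a = 0 := by
    rw [show (1 + 1 : ZMod 2) = 0 from by decide, zero_smul]
  rwa [add_smul, one_smul] at h

theorem exists_arrows {x y : GVert k S} (p : Quiver.Path x y) {a b : Label S}
    (h : word p = [a, b]) : ∃ (z : GVert k S) (e : x ⟶ z) (e' : z ⟶ y),
      arrowLabel e = a ∧ arrowLabel e' = b ∧ p = e.toPath.comp e'.toPath := by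
  cases p with
  | nil => simp [word] at h
  | cons p e' =>
    cases p with
    | nil => simp [word] at h
    | cons p e =>
      cases p with
      | nil =>
        simp only [word, List.nil_append, List.cons_append, List.cons.injEq, and_true] at h
        exact ⟨_, e, e', h.1, h.2, rfl⟩
      | cons p e'' =>
        have h' := congrArg List.length h
        simp [word] at h'

theorem pathD_toPath {x y : GVert k S} (e : x ⟶ y) : pathD e.toPath = arrowD e := by
  have h : pathD e.toPath = pathD Quiver.Path.nil * PathAlg.ofPath e.toPath +
    PathAlg.ofPath Quiver.Path.nil * arrowD e := rfl
  rw [h, pathD, zero_mul, zero_add]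
  exact idem_mul_arrowD e

theorem pathD_eq_zero {x y : GVert k S} (p : Quiver.Path x y)
    (h : ∀ i : S, Label.C i ∉ word p) : pathD p = 0 := by
  induction p with
  | nil => rfl
  | cons p e ih =>
    rw [pathD, ih fun i hi => h i (by simp [word, hi])]
    obtain ⟨ℓ, hl⟩ := e
    cases ℓ with
    | C i => exact absurd (by simp [word, arrowLabel]) (h i)
    | _ => simp [arrowD]

/-- The path of length one consisting of the `C_i`-loop at `x`. -/
def cLoop (i : S) (x : GVert k S) : Quiver.Path x x :=
  Quiver.Hom.toPath (⟨Label.C i, rfl⟩ : x ⟶ x)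

theorem cLoop_mul_arrowD (i : S) {x y : GVert k S} (e : x ⟶ y) :
    ofPath (cLoop i x) * quotMap (gRel k S) (arrowD e) =
      quotMap (gRel k S) (arrowD e) * ofPath (cLoop i y) := by
  obtain ⟨ℓ, h⟩ := e
  cases ℓ with
  | C j =>
    obtain rfl : x = y := h
    exact (uLoop_mul_path j.1 (cLoop i x)).symm
  | _ => simp [arrowD]

theorem pathD_wordEq {x y : GVert k S} {p q : Quiver.Path x y} (h : WordEq S (word p) (word q)) :
    quotMap (gRel k S) (pathD p) = quotMap (gRel k S) (pathD q) := by
  generalize hp : word p = w at h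
  generalize hq : word q = w' at h
  cases h with
  | c_central i a =>
    obtain ⟨z, c, e, hc, he, rfl⟩ := exists_arrows p hp
    obtain ⟨z', e', c', he', hc', rfl⟩ := exists_arrows q hq
    obtain ⟨ℓ, c⟩ := c
    obtain ⟨ℓ', c'⟩ := c'
    obtain rfl : ℓ = Label.C i := hc
    obtain rfl : ℓ' = Label.C i := hc'
    obtain rfl : x = z := c
    obtain rfl : z' = y := c'
    obtain rfl : e = e' := Subtype.ext (he.trans he'.symm)
    rw [pathD_comp, pathD_comp, pathD_toPath, pathD_toPath, pathD_toPath]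
    have h1 := uLoop_mul_arrow i.1 e
    have h2 := cLoop_mul_arrowD i e
    simp only [map_add, map_mul]
    rw [add_comm]
    exact congrArg₂ (· + ·) h2 h1
  | _ => rw [pathD_eq_zero p (by simp [hp]), pathD_eq_zero q (by simp [hq])]

theorem pathD_wordZero {x y : GVert k S} {p : Quiver.Path x y} (h : WordZero S (word p)) :
    quotMap (gRel k S) (pathD p) = 0 := by
  generalize hp : word p = w at h
  cases h with
  | c_c i =>
    obtain ⟨z, c, c', hc, hc', rfl⟩ := exists_arrows p hp
    obtain ⟨ℓ, c⟩ := c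
    obtain ⟨ℓ', c'⟩ := c'
    obtain rfl : ℓ = Label.C i := hc
    obtain rfl : ℓ' = Label.C i := hc'
    obtain rfl : x = z := c
    obtain rfl : x = y := c'
    rw [pathD_comp, pathD_toPath]
    simp only [map_add, map_mul]
    have h1 : ofPath (uLoop i.1 x) * ofPath (cLoop i x) =
      ofPath (cLoop i x) * ofPath (uLoop i.1 x) := uLoop_mul_path i.1 (cLoop i x)
    have h2 := add_self (ofPath (cLoop i x) * ofPath (uLoop i.1 x))
    nth_rw 1 [← h1] at h2
    exact h2
  | _ => rw [pathD_eq_zero p (by simp [hp]), map_zero]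

theorem preD_gRel {a : PathAlg (ZMod 2) (GVert k S)} (h : a ∈ gRel k S) :
    quotMap (gRel k S) (preD k S a) = 0 := by
  rcases h with (⟨x, y, p, q, h, rfl⟩ | ⟨x, y, p, h, rfl⟩) | ⟨x, i, -, -, rfl⟩
  · rw [map_sub, map_sub, preD, PathAlg.lin_ofPath, PathAlg.lin_ofPath, pathD_wordEq h, sub_self]
  · rw [preD, PathAlg.lin_ofPath, pathD_wordZero h]
  · rw [preD, PathAlg.lin_ofPath, pathD_eq_zero, map_zero]
    intro j hj
    simp [uLoop, Quiver.Hom.toPath, word, arrowLabel] at hj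

theorem quot_eq_zero_iff {a : PathAlg (ZMod 2) (GVert k S)} :
    quotMap (gRel k S) a = 0 ↔ a ∈ TwoSidedIdeal.span (gRel k S) := by
  rw [← map_zero (quotMap (gRel k S))]
  exact (RingCon.eq _).trans (TwoSidedIdeal.mem_iff _ _).symm

theorem preD_span {a : PathAlg (ZMod 2) (GVert k S)} (h : a ∈ TwoSidedIdeal.span (gRel k S)) :
    quotMap (gRel k S) (preD k S a) = 0 := by
  induction h using TwoSidedIdeal.span_induction with
  | mem a h => exact preD_gRel h
  | zero => simp
  | add a b _ _ ha hb => rw [map_add, map_add, ha, hb, add_zero]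
  | neg a _ ha => rw [map_neg, map_neg, ha, neg_zero]
  | left_absorb a b hb h =>
    rw [preD_mul, map_add, map_mul, map_mul, h, quot_eq_zero_iff.2 hb, mul_zero, mul_zero,
      add_zero]
  | right_absorb a b hb h =>
    rw [preD_mul, map_add, map_mul, map_mul, h, quot_eq_zero_iff.2 hb, zero_mul, zero_mul,
      add_zero]

/-- The differential of the quiver algebra, induced by the differential of the path algebra. -/
def d (k : ℕ) (S : Finset (Fin n)) : GS k S →+ GS k S where
  toFun := Quotient.lift (fun a => quotMap (gRel k S) (preD k S a)) fun a b h => by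
    have h' := preD_span ((TwoSidedIdeal.rel_iff _ _ _).1 h)
    rwa [map_sub, map_sub, sub_eq_zero] at h'
  map_zero' := by
    show quotMap (gRel k S) (preD k S 0) = 0
    simp
  map_add' := by
    rintro ⟨a⟩ ⟨b⟩
    show quotMap (gRel k S) (preD k S (a + b)) = _
    rw [map_add, map_add]

theorem d_quotMap (a : PathAlg (ZMod 2) (GVert k S)) :
    d k S (quotMap (gRel k S) a) = quotMap (gRel k S) (preD k S a) := rfl

/-! ### Gradings -/

/-- The degree of a path, the sum of the degrees of the labels of its arrows. -/
def pathDeg {G : Type} [AddCommGroup G] (δ : Label S → G) {x y : GVert k S}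
    (p : Quiver.Path x y) : G := ((word p).map δ).sum

/-- The homogeneous parts of the quiver algebra for the degrees `δ` of the labels: the subgroup
spanned by the classes of the paths of the given degree. -/
def part {G : Type} [AddCommGroup G] (k : ℕ) (δ : Label S → G) (g : G) : AddSubgroup (GS k S) :=
  AddSubgroup.closure {a | ∃ (x y : GVert k S) (p : Quiver.Path x y),
    pathDeg δ p = g ∧ a = ofPath p}

end GS

/-- The Maslov degrees of the labels. -/
def Label.maslov {n : ℕ} {S : Finset (Fin n)} : Label S → ℤ
  | .R i => if i ∈ S then -1 else 0
  | .L i => if i ∈ S then -1 else 0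
  | .U i => if i ∈ S then -2 else 0
  | .C _ => -1

/-- The Alexander multi-degrees of the labels. -/
def Label.alex {n : ℕ} {S : Finset (Fin n)} : Label S → Fin n → HalfInt
  | .R i => Pi.single i (halves 1)
  | .L i => Pi.single i (halves 1)
  | .U i => Pi.single i (halves 2)
  | .C i => Pi.single i.1 (halves 2)

/-- The unrefined Alexander multi-degrees of the labels, in `ℤ^{2n}`; the two components at `i` are
the coefficients of the basis elements `τ_i` and `β_i`. -/
def Label.unrefined {n : ℕ} {S : Finset (Fin n)} : Label S → Fin n → ℤ × ℤ
  | .R i => Pi.single i (1, 0)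
  | .L i => Pi.single i (0, 1)
  | .U i => Pi.single i (1, 1)
  | .C i => Pi.single i.1 (1, 1)

/-- The Maslov degree and the Alexander multi-degree of a label. -/
def Label.deg {n : ℕ} {S : Finset (Fin n)} (ℓ : Label S) : ℤ × (Fin n → HalfInt) :=
  (ℓ.maslov, ℓ.alex)

/-- The Maslov degree and the unrefined Alexander multi-degree of a label. -/
def Label.unrefinedDeg {n : ℕ} {S : Finset (Fin n)} (ℓ : Label S) : ℤ × (Fin n → ℤ × ℤ) :=
  (ℓ.maslov, ℓ.unrefined)

/-- The element of `B(n,k,S)` that corresponds to an arrow from `x` to `y` with the given label: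
`f_{x,y}` for the labels `R_i` and `L_i`, and `U_i I_x` and `C_i I_x` for `U_i` and `C_i`. -/
def arrowImage {n k : ℕ} {S : Finset (Fin n)} (x y : IState n k) : Label S → BS k S
  | .R _ => BS.f S x y
  | .L _ => BS.f S x y
  | .U i => (MvPolynomial.X i : Poly n) • BS.idem S x
  | .C i => BS.C k i * BS.idem S x

end

end OSz

/-! Both algebras are given by generators and relations, and the isomorphism is obtained from two
mutually inverse homomorphisms. From the quiver algebra to `BS` the arrows have prescribed images,
and only the relations need checking (`GS.rep_wordEq`, `GS.rep_wordZero`). The computation behind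
this is that multiplying `f_{x,w}` by a move from `w` to `y` across line `i` gives `f_{x,y}` if the
move leads away from `x`, and `U_i f_{x,y}` if it leads back (`turn`, `BS.f_mul_f_of_joins`).

The other direction needs an element of the quiver algebra to play the role of `f_{x,y}`: the class
of a shortest path. A state is encoded by the numbers of its dots in region `r` or beyond, and `wt x
y r` is the difference of these numbers for `y` and `x`. A move changes this function by one at one
place. If `x ≠ y`, some last move into `y` leads away from `x` (`exists_last_move`), so shortest
paths exist. Two different last moves of this kind are never across equal or adjacent lines
(`GS.not_adjacent`), since `wt` jumps by at most one from region to region. Hence they commute, and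
a diamond argument shows that all shortest paths have the same class (`GS.Geodesic.unique`).
Appending a move to a shortest path either lengthens it or cancels its last arrow by `RL = U` or `LR
= U` (`GS.geo_mul_arrow`). The structure monomial satisfies the same recursion
(`structMonomial_step`), so shortest paths multiply as the `f_{x,y}` do (`GS.geo_mul_geo`). The
remaining relations of `B(n,k)` are relations of the quiver algebra, and the central square-zero
elements `C_i` give the map from the exterior algebra, which is commutative in characteristic two.

The differentials agree because both are derivations and they agree on arrows. For the gradings,
homogeneity of the relations gives a ring homomorphism from the quiver algebra to its group algebra
over the grading group. Its coefficients are the projections to the homogeneous parts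
(`GS.coaction`), so directness of the sum needs no basis. Paths correspond to additive generators of
the same degree (`GS.exists_gen`), and additive generators come from homogeneous elements
(`GS.ofBS_gen_mem_part`). Parts therefore go onto parts (`GS.map_part`), and the dg structure on
`BS` is transported from the quiver algebra. -/

namespace OSz

noncomputable section

section

/-! ### The universal properties of path algebras and of their quotients -/

/-- A representation of a quiver in a ring: a complete family of orthogonal idempotents, one for
each vertex, and for each arrow an element that is fixed by the idempotents of its ends. -/
structure QuiverRep (V A : Type) [Quiver V] [Fintype V] [Ring A] where
  vert : V → A
  arrow : ∀ {x y : V}, (x ⟶ y) → A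
  complete : CompleteOrthogonalIdempotents vert
  vert_mul_arrow : ∀ {x y : V} (e : x ⟶ y), vert x * arrow e = arrow e
  arrow_mul_vert : ∀ {x y : V} (e : x ⟶ y), arrow e * vert y = arrow e

namespace QuiverRep

variable {K V A : Type} [CommRing K] [Quiver V] [Fintype V] [Ring A] (ρ : QuiverRep V A)

/-- The image of a path under a representation. -/
def path {x : V} : {y : V} → Quiver.Path x y → A
  | _, .nil => ρ.vert x
  | _, .cons p e => path p * ρ.arrow e

theorem vert_mul_path {x y : V} (p : Quiver.Path x y) : ρ.vert x * ρ.path p = ρ.path p := by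
  induction p with
  | nil => exact ρ.complete.idem x
  | cons p e ih => rw [path, ← mul_assoc, ih]

theorem path_mul_vert {x y : V} (p : Quiver.Path x y) : ρ.path p * ρ.vert y = ρ.path p := by
  cases p with
  | nil => exact ρ.complete.idem x
  | cons p e => rw [path, mul_assoc, ρ.arrow_mul_vert]

theorem path_comp {x y z : V} (p : Quiver.Path x y) (q : Quiver.Path y z) :
    ρ.path (p.comp q) = ρ.path p * ρ.path q := by
  induction q with
  | nil => exact (ρ.path_mul_vert p).symm
  | cons q e ih => rw [Quiver.Path.comp_cons, path, path, ih, mul_assoc]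

theorem path_mul_of_ne {x y y' z : V} (h : y' ≠ y) (p : Quiver.Path x y)
    (q : Quiver.Path y' z) : ρ.path p * ρ.path q = 0 := by
  have h0 : ρ.vert y * ρ.vert y' = 0 := ρ.complete.ortho (Ne.symm h)
  rw [← path_mul_vert, ← ρ.vert_mul_path q, mul_assoc, ← mul_assoc (ρ.vert y), h0, zero_mul,
    mul_zero]

theorem path_toPath {x y : V} (e : x ⟶ y) : ρ.path e.toPath = ρ.arrow e :=
  ρ.vert_mul_arrow e

variable [DecidableEq V]

/-- The ring homomorphism from the path algebra given by a representation of the quiver and a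
central homomorphism on the coefficients. -/
def lift (φ : K →+* A) (hφ : ∀ c a, φ c * a = a * φ c) : PathAlg K V →+* A :=
  -- Centrality of the image of `φ` makes `A` a `K`-algebra, so that extending linearly from paths
  -- is compatible with products.
  letI : Algebra K A := φ.toAlgebra' hφ
  { toFun := PathAlg.lin (K := K) fun p => ρ.path p.2.2
    map_zero' := map_zero _
    map_add' := map_add _
    map_one' := by
      have h : (1 : PathAlg K V) = ∑ x : V, PathAlg.idem x := rfl
      rw [h, map_sum, ← ρ.complete.complete]
      exact Finset.sum_congr rfl fun x _ => PathAlg.lin_ofPath _ _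
    map_mul' := fun a b => by
      induction a using PathAlg.induction_on with
      | zero => simp
      | add a a' h h' => simp only [add_mul, map_add, h, h']
      | smul c a h => simp only [smul_mul_assoc, map_smul, h]
      | path p =>
        induction b using PathAlg.induction_on with
        | zero => simp
        | add b b' h h' => simp only [mul_add, map_add, h, h']
        | smul c b h => simp only [mul_smul_comm, map_smul, h]
        | path q =>
          rename_i x y y' z
          by_cases h : y' = y
          · subst h
            rw [PathAlg.ofPath_mul_ofPath]
            simp only [PathAlg.lin_ofPath, path_comp]
          · rw [PathAlg.ofPath_mul_of_ne h, map_zero]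
            simp only [PathAlg.lin_ofPath, path_mul_of_ne ρ h] }

variable (φ : K →+* A) (hφ : ∀ c a, φ c * a = a * φ c)

@[simp] theorem lift_ofPath {x y : V} (p : Quiver.Path x y) :
    ρ.lift φ hφ (PathAlg.ofPath p) = ρ.path p :=
  letI : Algebra K A := φ.toAlgebra' hφ
  PathAlg.lin_ofPath (K := K) _ p

@[simp] theorem lift_smul (c : K) (a : PathAlg K V) :
    ρ.lift φ hφ (c • a) = φ c * ρ.lift φ hφ a :=
  letI : Algebra K A := φ.toAlgebra' hφ
  map_smul (PathAlg.lin (K := K) fun p : AnyPath V => ρ.path p.2.2) c a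

end QuiverRep

/-- The ring homomorphism from the quotient by the ideal generated by a set that is induced by a
ring homomorphism vanishing on the set. -/
def quotLift {A B : Type} [Ring A] [Ring B] (R : Set A) (f : A →+* B) (h : ∀ a ∈ R, f a = 0) :
    (TwoSidedIdeal.span R).ringCon.Quotient →+* B :=
  (TwoSidedIdeal.span R).ringCon.lift f fun a b hab => by
    have h1 : TwoSidedIdeal.span R ≤ TwoSidedIdeal.ker f :=
      TwoSidedIdeal.span_le.2 fun a ha => (TwoSidedIdeal.mem_ker f).2 (h a ha)
    have h2 := (TwoSidedIdeal.mem_ker f).1 (h1 ((TwoSidedIdeal.rel_iff _ _ _).1 hab))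
    rw [map_sub, sub_eq_zero] at h2
    exact h2

@[simp] theorem quotLift_quotMap {A B : Type} [Ring A] [Ring B] (R : Set A) (f : A →+* B)
    (h : ∀ a ∈ R, f a = 0) (a : A) : quotLift R f h (quotMap R a) = f a := rfl

theorem quotMap_surjective {A : Type} [Ring A] (R : Set A) : Function.Surjective (quotMap R) :=
  RingCon.mk'_surjective _

theorem quotMap_eq_zero {A : Type} [Ring A] {R : Set A} {a : A} (h : a ∈ R) : quotMap R a = 0 := by
  rw [← map_zero (quotMap R)]
  exact (RingCon.eq _).2 ((TwoSidedIdeal.mem_iff _ _).1 (TwoSidedIdeal.subset_span h))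

/-- Subgroups that span a group and are separated by endomorphisms form a direct sum
decomposition. -/
theorem isInternal_of_projections {A G : Type} [AddCommGroup A] [DecidableEq G]
    (𝒜 : G → AddSubgroup A) (π : G → A →+ A) (same : ∀ g, ∀ a ∈ 𝒜 g, π g a = a)
    (ne : ∀ g h, ∀ a ∈ 𝒜 g, h ≠ g → π h a = 0) (top : ⨆ g, 𝒜 g = ⊤) :
    DirectSum.IsInternal 𝒜 := by
  constructor
  · rw [injective_iff_map_eq_zero]
    intro x hx
    -- The endomorphism `π h` reads off the component in degree `h` of a formal sum, so a sum that
    -- vanishes in `A` has only zero components.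
    have key : ∀ (h : G) (x : DirectSum G fun g => 𝒜 g),
        π h (DirectSum.coeAddMonoidHom 𝒜 x) = x h := by
      intro h x
      induction x using DirectSum.induction_on with
      | zero => simp
      | of g a =>
        rw [DirectSum.coeAddMonoidHom_of]
        by_cases hg : h = g
        · subst hg
          rw [DirectSum.of_eq_same, same _ _ a.2]
        · rw [DirectSum.of_eq_of_ne _ _ _ hg, ne g h a a.2 hg]
          rfl
      | add x y hx hy => simp [hx, hy]
    refine DFinsupp.ext fun h => Subtype.ext ?_
    have := key h x
    rw [hx, map_zero] at this
    exact this.symm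
  · intro a
    have ha : a ∈ ⨆ g, 𝒜 g := by rw [top]; trivial
    induction ha using AddSubgroup.iSup_induction' with
    | hp g a h => exact ⟨DirectSum.of (fun g => 𝒜 g) g ⟨a, h⟩, by simp⟩
    | h1 => exact ⟨0, map_zero _⟩
    | hadd a b _ _ ha hb =>
      obtain ⟨x, rfl⟩ := ha
      obtain ⟨y, rfl⟩ := hb
      exact ⟨x + y, map_add _ _ _⟩

end

section

/-! ### The quiver algebra as a differential graded algebra -/

namespace GS

variable {n k : ℕ} {S : Finset (Fin n)}

/-! ### Products of path classes, and the central elements `U_i` and `C_i` -/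

theorem ofPath_cons {x y z : GVert k S} (p : Quiver.Path x y) (e : y ⟶ z) :
    ofPath (p.cons e) = ofPath p * ofArrow e :=
  ofPath_comp p e.toPath

theorem ofPath_nil (x : GVert k S) : ofPath (Quiver.Path.nil : Quiver.Path x x) = idem x := rfl

theorem complete_idem : CompleteOrthogonalIdempotents fun x : GVert k S => (idem x : GS k S) :=
  (PathAlg.complete_idem (K := ZMod 2) (V := GVert k S)).map (quotMap (gRel k S))

theorem ofPath_mul_idem {x y : GVert k S} (p : Quiver.Path x y) :
    ofPath p * idem y = ofPath p := by
  rw [← ofPath_nil, ← ofPath_comp, Quiver.Path.comp_nil]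

theorem idem_mul_ofPath {x y : GVert k S} (p : Quiver.Path x y) :
    idem x * ofPath p = ofPath p := by
  rw [← ofPath_nil, ← ofPath_comp, Quiver.Path.nil_comp]

/-- An additive subgroup that contains the classes of all paths is everything. -/
theorem eq_top_of_ofPath_mem (H : AddSubgroup (GS k S))
    (h : ∀ (x y : GVert k S) (p : Quiver.Path x y), ofPath p ∈ H) : H = ⊤ := by
  rw [eq_top_iff]
  rintro a -
  obtain ⟨a, rfl⟩ := quotMap_surjective _ a
  induction a using PathAlg.induction_on with
  | zero => rw [map_zero]; exact H.zero_mem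
  | add a b ha hb => rw [map_add]; exact H.add_mem ha hb
  | smul c a ha =>
    -- The only scalars are 0 and 1, so an additive subgroup is automatically a linear subspace.
    fin_cases c
    · change quotMap _ ((0 : ZMod 2) • a) ∈ H
      rw [zero_smul, map_zero]
      exact H.zero_mem
    · change quotMap _ ((1 : ZMod 2) • a) ∈ H
      rwa [one_smul]
  | path p => exact h _ _ p

theorem induction_on {P : GS k S → Prop} (a : GS k S) (zero : P 0)
    (add : ∀ a b, P a → P b → P (a + b))
    (path : ∀ {x y : GVert k S} (p : Quiver.Path x y), P (ofPath p)) : P a := by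
  have h := eq_top_of_ofPath_mem (AddSubgroup.closure
    {a : GS k S | ∃ (x y : GVert k S) (p : Quiver.Path x y), a = ofPath p})
    fun x y p => AddSubgroup.subset_closure ⟨x, y, p, rfl⟩
  have ha : a ∈ AddSubgroup.closure
    {a : GS k S | ∃ (x y : GVert k S) (p : Quiver.Path x y), a = ofPath p} := by
    rw [h]; trivial
  induction ha using AddSubgroup.closure_induction with
  | mem a ha => obtain ⟨x, y, p, rfl⟩ := ha; exact path p
  | zero => exact zero
  | add a b _ _ ha hb => exact add a b ha hb
  | neg a _ ha => rwa [neg_eq_of_add_eq_zero_left (add_self a)]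

/-- The structure map on coefficients that are the same at all vertices. -/
def uPoly (k : ℕ) (S : Finset (Fin n)) : Poly n →+* GS k S :=
  (Subalgebra.center (ZMod 2) (GS k S)).val.toRingHom.comp (polyHom k S).toRingHom

theorem uPoly_comm (c : Poly n) (a : GS k S) : uPoly k S c * a = a * uPoly k S c :=
  (Subalgebra.mem_center_iff.1 (polyHom k S c).2 a).symm

theorem uPoly_X (i : Fin n) : uPoly k S (MvPolynomial.X i) = U i :=
  congrArg Subtype.val (MvPolynomial.aeval_X _ i)

theorem structHom_apply (c : IState n k → Poly n) :
    structHom k S c = ∑ x : GVert k S, uPoly k S (c x) * idem x := rfl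

theorem U_mul_ofPath (i : Fin n) {x y : GVert k S} (p : Quiver.Path x y) :
    U i * ofPath p = ofPath (uLoop i x) * ofPath p := by
  rw [U, Finset.sum_mul, Finset.sum_eq_single x]
  · exact fun z _ hz => ofPath_mul_of_ne (Ne.symm hz) _ _
  · simp

theorem U_mul_idem (i : Fin n) (x : GVert k S) : U i * idem x = ofPath (uLoop i x) := by
  rw [← ofPath_nil, U_mul_ofPath, ofPath_nil, ofPath_mul_idem]

theorem ofPath_mul_uLoop (i : Fin n) {x y : GVert k S} (p : Quiver.Path x y) :
    ofPath p * ofPath (uLoop i y) = U i * ofPath p := by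
  rw [U_mul_ofPath, uLoop_mul_path]

/-- The element `C_i` of the quiver algebra, the sum of all loops with label `C_i`. -/
def sumC (k : ℕ) {S : Finset (Fin n)} (i : S) : GS k S := ∑ x : GVert k S, ofPath (cLoop i x)

theorem cLoop_mul_arrow (i : S) {x y : GVert k S} (e : x ⟶ y) :
    ofPath (cLoop i x) * ofPath e.toPath = ofPath e.toPath * ofPath (cLoop i y) := by
  rw [← ofPath_comp, ← ofPath_comp]
  obtain ⟨ℓ, h⟩ := e
  exact ofPath_eq (S := S) (WordEq.c_central i ℓ)

theorem cLoop_mul_path (i : S) {x y : GVert k S} (p : Quiver.Path x y) :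
    ofPath (cLoop i x) * ofPath p = ofPath p * ofPath (cLoop i y) := by
  induction p with
  | nil => rw [← ofPath_comp, ← ofPath_comp, Quiver.Path.comp_nil, Quiver.Path.nil_comp]
  | cons p e ih =>
    rw [ofPath_cons, ← mul_assoc, ih, mul_assoc, mul_assoc, ofArrow, cLoop_mul_arrow]

theorem sumC_mul_ofPath (i : S) {x y : GVert k S} (p : Quiver.Path x y) :
    sumC k i * ofPath p = ofPath (cLoop i x) * ofPath p := by
  rw [sumC, Finset.sum_mul, Finset.sum_eq_single x]
  · exact fun z _ hz => ofPath_mul_of_ne (Ne.symm hz) _ _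
  · simp

theorem ofPath_mul_sumC (i : S) {x y : GVert k S} (p : Quiver.Path x y) :
    ofPath p * sumC k i = ofPath p * ofPath (cLoop i y) := by
  rw [sumC, Finset.mul_sum, Finset.sum_eq_single y]
  · exact fun z _ hz => ofPath_mul_of_ne hz _ _
  · simp

theorem sumC_mul_idem (i : S) (x : GVert k S) : sumC k i * idem x = ofPath (cLoop i x) := by
  rw [← ofPath_nil, sumC_mul_ofPath, ofPath_nil, ofPath_mul_idem]

theorem sumC_comm (i : S) (a : GS k S) : sumC k i * a = a * sumC k i := by
  induction a using induction_on with
  | zero => simp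
  | add a b ha hb => rw [mul_add, add_mul, ha, hb]
  | path p => rw [sumC_mul_ofPath, ofPath_mul_sumC, cLoop_mul_path]

theorem sumC_mul_self (i : S) : sumC k i * sumC k i = 0 := by
  nth_rw 2 [sumC]
  rw [Finset.mul_sum]
  refine Finset.sum_eq_zero fun x _ => ?_
  rw [sumC_mul_ofPath, ← ofPath_comp]
  exact quotMap_eq_zero
    (Or.inl (Or.inr ⟨x, x, (cLoop i x).comp (cLoop i x), WordZero.c_c i, rfl⟩))

/-! #### The differential -/

theorem d_mul (a b : GS k S) : d k S (a * b) = d k S a * b + a * d k S b := by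
  obtain ⟨a, rfl⟩ := quotMap_surjective _ a
  obtain ⟨b, rfl⟩ := quotMap_surjective _ b
  rw [← map_mul, d_quotMap, d_quotMap, d_quotMap, preD_mul, map_add, map_mul, map_mul]

theorem d_ofPath {x y : GVert k S} (p : Quiver.Path x y) :
    d k S (ofPath p) = quotMap (gRel k S) (pathD p) := by
  rw [ofPath, d_quotMap, preD, PathAlg.lin_ofPath]

theorem d_ofArrow {x y : GVert k S} (e : x ⟶ y) :
    d k S (ofArrow e) = quotMap (gRel k S) (arrowD e) := by
  rw [ofArrow, d_ofPath, pathD_toPath]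

theorem d_idem (x : GVert k S) : d k S (idem x) = 0 := by
  rw [← ofPath_nil, d_ofPath, pathD, map_zero]

theorem d_uLoop (i : Fin n) (x : GVert k S) : d k S (ofPath (uLoop i x)) = 0 := by
  rw [uLoop, d_ofPath, pathD_toPath]
  exact map_zero _

theorem d_one : d k S 1 = 0 := by
  have h := d_mul (1 : GS k S) 1
  simpa using h

/-- The differential kills 1 and every `U_i`-loop, hence by the Leibniz rule every polynomial in the
`U_i`. This is what makes it linear over the structure map. -/
theorem d_uPoly (c : Poly n) : d k S (uPoly k S c) = 0 := by
  induction c using MvPolynomial.induction_on with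
  | C a =>
    fin_cases a
    · change d k S (uPoly k S (MvPolynomial.C 0)) = 0
      rw [map_zero, map_zero, map_zero]
    · change d k S (uPoly k S (MvPolynomial.C 1)) = 0
      rw [map_one, map_one, d_one]
  | add p q hp hq => rw [map_add, map_add, hp, hq, add_zero]
  | mul_X p i hp =>
    rw [map_mul, d_mul, hp, uPoly_X, zero_mul, zero_add, U, map_sum]
    simp [d_uLoop]

theorem d_structHom (c : IState n k → Poly n) : d k S (structHom k S c) = 0 := by
  rw [structHom_apply, map_sum]
  refine Finset.sum_eq_zero fun x _ => ?_
  rw [d_mul, d_uPoly, d_idem, zero_mul, mul_zero, add_zero]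

/-- Splitting off the last arrow of a path, the Leibniz rule applied twice produces the mixed term
`∂p · ∂e` two times, and these cancel in characteristic two. On one arrow only `C_i ↦ U_i ↦ 0` has
to be considered. -/
theorem d_d (a : GS k S) : d k S (d k S a) = 0 := by
  induction a using induction_on with
  | zero => simp
  | add a b ha hb => rw [map_add, map_add, ha, hb, add_zero]
  | path p =>
    induction p with
    | nil => rw [ofPath_nil, d_idem, map_zero]
    | cons p e ih =>
      have he : d k S (d k S (ofArrow e)) = 0 := by
        rw [d_ofArrow]
        obtain ⟨ℓ, h⟩ := e
        cases ℓ with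
        | C i => exact d_uLoop i.1 _
        | _ => simp [arrowD]
      rw [ofPath_cons, d_mul, map_add, d_mul, d_mul, ih, he, zero_mul, mul_zero, zero_add,
        add_zero]
      exact add_self _

/-! #### Gradings -/

variable {G : Type} [AddCommGroup G]

theorem pathDeg_nil (δ : Label S → G) (x : GVert k S) :
    pathDeg δ (Quiver.Path.nil : Quiver.Path x x) = 0 := rfl

theorem pathDeg_cons (δ : Label S → G) {x y z : GVert k S} (p : Quiver.Path x y) (e : y ⟶ z) :
    pathDeg δ (p.cons e) = pathDeg δ p + δ (arrowLabel e) := by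
  simp [pathDeg, word]

theorem pathDeg_toPath (δ : Label S → G) {x y : GVert k S} (e : x ⟶ y) :
    pathDeg δ e.toPath = δ (arrowLabel e) := by
  rw [Quiver.Hom.toPath, pathDeg_cons, pathDeg_nil, zero_add]

theorem pathDeg_comp (δ : Label S → G) {x y z : GVert k S} (p : Quiver.Path x y)
    (q : Quiver.Path y z) : pathDeg δ (p.comp q) = pathDeg δ p + pathDeg δ q := by
  induction q with
  | nil => rw [Quiver.Path.comp_nil, pathDeg_nil, add_zero]
  | cons q e ih => rw [Quiver.Path.comp_cons, pathDeg_cons, pathDeg_cons, ih, add_assoc]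

theorem ofPath_mem_part (δ : Label S → G) {x y : GVert k S} (p : Quiver.Path x y) :
    ofPath p ∈ part k δ (pathDeg δ p) :=
  AddSubgroup.subset_closure ⟨x, y, p, rfl, rfl⟩

theorem ofArrow_mem_part (δ : Label S → G) {x y : GVert k S} (e : x ⟶ y) :
    ofArrow e ∈ part k δ (δ (arrowLabel e)) :=
  pathDeg_toPath δ e ▸ ofPath_mem_part δ e.toPath

theorem idem_mem_part (δ : Label S → G) (x : GVert k S) : idem x ∈ part k δ 0 :=
  ofPath_mem_part δ (Quiver.Path.nil : Quiver.Path x x)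

theorem one_mem_part (δ : Label S → G) : (1 : GS k S) ∈ part k δ 0 := by
  rw [← complete_idem.complete]
  exact sum_mem fun x _ => idem_mem_part δ x

theorem mul_mem_part (δ : Label S → G) {g h : G} {a b : GS k S} (ha : a ∈ part k δ g)
    (hb : b ∈ part k δ h) : a * b ∈ part k δ (g + h) := by
  induction ha using AddSubgroup.closure_induction with
  | zero => rw [zero_mul]; exact zero_mem _
  | add a a' _ _ ha ha' => rw [add_mul]; exact add_mem ha ha'
  | neg a _ ha => rw [neg_mul]; exact neg_mem ha
  | mem a ha =>
    obtain ⟨x, y, p, rfl, rfl⟩ := ha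
    induction hb using AddSubgroup.closure_induction with
    | zero => rw [mul_zero]; exact zero_mem _
    | add a a' _ _ ha ha' => rw [mul_add]; exact add_mem ha ha'
    | neg a _ ha => rw [mul_neg]; exact neg_mem ha
    | mem b hb =>
      obtain ⟨y', z, q, rfl, rfl⟩ := hb
      by_cases h : y' = y
      · subst h
        rw [← ofPath_comp, ← pathDeg_comp]
        exact ofPath_mem_part δ _
      · rw [ofPath_mul_of_ne h]
        exact zero_mem _

/-- The representation of `Γ(n,k,S)` in the group algebra over the quiver algebra in which each
path goes to its class at its degree. -/
def gradedRep (k : ℕ) (δ : Label S → G) : QuiverRep (GVert k S) (AddMonoidAlgebra (GS k S) G) where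
  vert x := AddMonoidAlgebra.single 0 (idem x)
  arrow e := AddMonoidAlgebra.single (δ (arrowLabel e)) (ofArrow e)
  complete := (complete_idem (k := k) (S := S)).map
    (AddMonoidAlgebra.singleZeroRingHom (R := GS k S) (M := G))
  vert_mul_arrow e := by
    rw [AddMonoidAlgebra.single_mul_single, zero_add, ofArrow, idem_mul_ofPath]
  arrow_mul_vert e := by
    rw [AddMonoidAlgebra.single_mul_single, add_zero, ofArrow, ofPath_mul_idem]

theorem gradedRep_path (δ : Label S → G) {x y : GVert k S} (p : Quiver.Path x y) :
    (gradedRep k δ).path p = AddMonoidAlgebra.single (pathDeg δ p) (ofPath p) := by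
  induction p with
  | nil => rfl
  | cons p e ih =>
    rw [QuiverRep.path, ih, pathDeg_cons, ofPath_cons, ← AddMonoidAlgebra.single_mul_single]
    rfl

/-- A grading of the labels that makes the relations of the quiver algebra homogeneous. -/
def Homogeneous (δ : Label S → G) : Prop :=
  ∀ w w' : List (Label S), WordEq S w w' → (w.map δ).sum = (w'.map δ).sum

/-- The coaction that describes a grading of the quiver algebra. -/
def coaction (k : ℕ) {δ : Label S → G} (hδ : Homogeneous δ) :
    GS k S →+* AddMonoidAlgebra (GS k S) G :=
  quotLift _ ((gradedRep k δ).lift (algebraMap (ZMod 2) _) Algebra.commutes) (by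
    rintro _ ((⟨x, y, p, q, h, rfl⟩ | ⟨x, y, p, h, rfl⟩) | ⟨x, i, h, h', rfl⟩)
    · rw [map_sub, QuiverRep.lift_ofPath, QuiverRep.lift_ofPath, gradedRep_path, gradedRep_path,
        ofPath_eq h, pathDeg, pathDeg, hδ _ _ h, sub_self]
    -- Relations that set a single path to zero put no condition on the degrees: the class itself
    -- vanishes.
    · have h0 : ofPath p = 0 := quotMap_eq_zero (Or.inl (Or.inr ⟨x, y, p, h, rfl⟩))
      rw [QuiverRep.lift_ofPath, gradedRep_path, h0, AddMonoidAlgebra.single_zero]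
    · have h0 : ofPath (uLoop i x) = 0 := quotMap_eq_zero (Or.inr ⟨x, i, h, h', rfl⟩)
      rw [QuiverRep.lift_ofPath, gradedRep_path, h0, AddMonoidAlgebra.single_zero])

theorem coaction_ofPath {δ : Label S → G} (hδ : Homogeneous δ) {x y : GVert k S}
    (p : Quiver.Path x y) :
    coaction k hδ (ofPath p) = AddMonoidAlgebra.single (pathDeg δ p) (ofPath p) := by
  rw [coaction, ofPath, quotLift_quotMap, QuiverRep.lift_ofPath, gradedRep_path]
  rfl

/-- A grading by `G` is the same as a coaction of the group algebra, and the homogeneous elements of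
degree `g` are those sent to their multiple by `g`. The coefficient at `g` is thus the projection to
degree `g`. -/
theorem coaction_of_mem {δ : Label S → G} (hδ : Homogeneous δ) {g : G} {a : GS k S}
    (ha : a ∈ part k δ g) : coaction k hδ a = AddMonoidAlgebra.single g a := by
  induction ha using AddSubgroup.closure_induction with
  | mem a ha => obtain ⟨x, y, p, rfl, rfl⟩ := ha; exact coaction_ofPath hδ p
  | zero => simp
  | add a b _ _ ha hb => rw [map_add, ha, hb, AddMonoidAlgebra.single_add]
  | neg a _ ha =>
    rw [map_neg, ha, neg_eq_iff_add_eq_zero, ← AddMonoidAlgebra.single_add, add_neg_cancel,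
      AddMonoidAlgebra.single_zero]

/-- The projection to the homogeneous part of degree `g`. -/
def proj (k : ℕ) {δ : Label S → G} (hδ : Homogeneous δ) (g : G) : GS k S →+ GS k S :=
  ((Finsupp.applyAddHom g).comp
    (AddMonoidAlgebra.coeffAddEquiv (R := GS k S) (M := G)).toAddMonoidHom).comp
      (coaction k hδ).toAddMonoidHom

theorem proj_of_mem {δ : Label S → G} (hδ : Homogeneous δ) (g h : G) [Decidable (h = g)]
    (a : GS k S) (ha : a ∈ part k δ g) : proj k hδ h a = if h = g then a else 0 := by
  have h1 : proj k hδ h a = (coaction k hδ a).coeff h := rfl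
  rw [h1, coaction_of_mem hδ ha, AddMonoidAlgebra.coeff_single]
  split_ifs with h2
  · rw [h2, Finsupp.single_eq_same]
  · exact Finsupp.single_eq_of_ne h2

theorem iSup_part (δ : Label S → G) : ⨆ g, part k δ g = ⊤ :=
  eq_top_of_ofPath_mem _ fun _ _ p =>
    AddSubgroup.mem_iSup_of_mem (pathDeg δ p) (ofPath_mem_part δ p)

/-- By the Leibniz rule only arrows matter, and the only arrow with nonzero differential is a
`C_i`-loop, for which `hd` is the required shift of degree. -/
theorem d_mem_part (δ : Label S → G) (lam : G) (hd : ∀ i : S, δ (.U i.1) = δ (.C i) - lam) {g : G}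
    {a : GS k S} (ha : a ∈ part k δ g) : d k S a ∈ part k δ (g - lam) := by
  induction ha using AddSubgroup.closure_induction with
  | zero => rw [map_zero]; exact zero_mem _
  | add a b _ _ ha hb => rw [map_add]; exact add_mem ha hb
  | neg a _ ha => rw [map_neg]; exact neg_mem ha
  | mem a ha =>
    obtain ⟨x, y, p, rfl, rfl⟩ := ha
    induction p with
    | nil => rw [ofPath_nil, d_idem]; exact zero_mem _
    | @cons y z p e ih =>
      have he : d k S (ofArrow e) ∈ part k δ (δ (arrowLabel e) - lam) := by
        rw [d_ofArrow]
        obtain ⟨ℓ, h⟩ := e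
        cases ℓ with
        | C i =>
          have h1 := ofPath_mem_part δ (uLoop (k := k) (S := S) i.1 y)
          rw [uLoop, pathDeg_toPath] at h1
          change _ ∈ part k δ (δ (.C i) - lam)
          rw [← hd]
          exact h1
        | _ => simp [arrowD]
      rw [ofPath_cons, d_mul, pathDeg_cons]
      refine add_mem ?_ ?_
      · rw [add_sub_right_comm]
        exact mul_mem_part δ ih (ofArrow_mem_part δ e)
      · rw [add_sub_assoc]
        exact mul_mem_part δ (ofPath_mem_part δ p) he

theorem isDGAlgebra (k : ℕ) {δ : Label S → G} (hδ : Homogeneous δ) (lam : G)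
    (hd : ∀ i : S, δ (.U i.1) = δ (.C i) - lam) :
    IsDGAlgebra (structHom k S) (d k S) (part k δ) lam where
  map_smul_left c a := by rw [d_mul, d_structHom, zero_mul, zero_add]
  map_smul_right c a := by rw [d_mul, d_structHom, mul_zero, add_zero]
  sq_zero := d_d
  leibniz := d_mul
  one_mem := one_mem_part δ
  mul_mem _ _ _ _ := mul_mem_part δ
  internal := by
    classical
    exact isInternal_of_projections _ (proj k hδ)
      (fun g a ha => by rw [proj_of_mem hδ g g a ha, if_pos rfl])
      (fun g h a ha hne => by rw [proj_of_mem hδ g h a ha, if_neg hne]) (iSup_part δ)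
  d_mem _ _ := d_mem_part δ lam hd

end GS

/-- All relations between two words permute the labels, except `RL = U` and `LR = U`; there two
halves add up to one. -/
theorem Label.homogeneous_deg {n : ℕ} {S : Finset (Fin n)} :
    GS.Homogeneous (Label.deg (S := S)) := by
  intro w w' h
  cases h with
  | r_l i | l_r i =>
    refine Prod.ext ?_ ?_
    · simp only [List.map_cons, List.map_nil, List.sum_cons, List.sum_nil, Label.deg,
        Label.maslov, Prod.fst_add, Prod.fst_zero]
      split_ifs <;> rfl
    · simp only [List.map_cons, List.map_nil, List.sum_cons, List.sum_nil, Label.deg,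
        Label.alex, Prod.snd_add, add_zero, ← Pi.single_add, halves, ← add_smul]
      rfl
  | _ => simp [add_comm]

theorem Label.homogeneous_unrefinedDeg {n : ℕ} {S : Finset (Fin n)} :
    GS.Homogeneous (Label.unrefinedDeg (S := S)) := by
  intro w w' h
  cases h with
  | r_l i | l_r i =>
    refine Prod.ext ?_ ?_
    · simp only [List.map_cons, List.map_nil, List.sum_cons, List.sum_nil, Label.unrefinedDeg,
        Label.maslov, Prod.fst_add, Prod.fst_zero]
      split_ifs <;> rfl
    · simp only [List.map_cons, List.map_nil, List.sum_cons, List.sum_nil, Label.unrefinedDeg,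
        Label.unrefined, Prod.snd_add, add_zero, ← Pi.single_add]
      rfl
  | _ => simp [add_comm]

/-- The passage from the Alexander multi-degree to the single Alexander degree, as a
homomorphism. -/
def collapseHom {n : ℕ} (S : Finset (Fin n)) : ℤ × (Fin n → HalfInt) →+ ℤ × HalfInt where
  toFun := collapse S
  map_zero' := by simp [collapse]
  map_add' g h := by
    refine Prod.ext rfl ?_
    simp only [collapse, Prod.snd_add, Pi.add_apply, Finset.sum_add_distrib]
    abel

theorem GS.Homogeneous.comp {n : ℕ} {S : Finset (Fin n)} {G H : Type} [AddCommGroup G]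
    [AddCommGroup H] {δ : Label S → G} (hδ : GS.Homogeneous δ) (σ : G →+ H) :
    GS.Homogeneous fun ℓ => σ (δ ℓ) := by
  intro w w' h
  have := congrArg σ (hδ w w' h)
  rwa [map_list_sum, map_list_sum, List.map_map, List.map_map] at this

theorem Label.deg_U {n : ℕ} {S : Finset (Fin n)} (i : S) :
    Label.deg (S := S) (.U i.1) = Label.deg (.C i) - (1, 0) := by
  simp [Label.deg, Label.maslov, Label.alex]

theorem Label.unrefinedDeg_U {n : ℕ} {S : Finset (Fin n)} (i : S) :
    Label.unrefinedDeg (S := S) (.U i.1) = Label.unrefinedDeg (.C i) - (1, 0) := by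
  simp [Label.unrefinedDeg, Label.maslov, Label.unrefined]

theorem collapseHom_lam {n : ℕ} (S : Finset (Fin n)) : collapseHom S (1, 0) = (1, 0) := by
  simp [collapseHom, collapse]

end

section

/-! ### Moves of a dot in terms of weights -/

/-- The indicator of a region. -/
def has {n : ℕ} (x : Finset (Fin (n + 1))) (r : ℕ) : ℤ := ∑ j ∈ x, if r = j.val then 1 else 0

/-- The number of dots in region `r` or beyond. -/
def cnt {n : ℕ} (x : Finset (Fin (n + 1))) (r : ℕ) : ℤ := ∑ j ∈ x, if r ≤ j.val then 1 else 0

theorem cnt_eq_add_has {n : ℕ} (x : Finset (Fin (n + 1))) (r : ℕ) :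
    cnt x r = cnt x (r + 1) + has x r := by
  rw [cnt, cnt, has, ← Finset.sum_add_distrib]
  refine Finset.sum_congr rfl fun j _ => ?_
  split_ifs <;> omega

theorem has_val {n : ℕ} (x : Finset (Fin (n + 1))) (j : Fin (n + 1)) :
    has x j.val = if j ∈ x then 1 else 0 := by
  simp only [has, ← Fin.ext_iff, Finset.sum_ite_eq]

theorem has_castSucc {n : ℕ} (x : Finset (Fin (n + 1))) (i : Fin n) :
    has x i.val = if i.castSucc ∈ x then 1 else 0 := has_val x i.castSucc

theorem has_succ {n : ℕ} (x : Finset (Fin (n + 1))) (i : Fin n) :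
    has x (i.val + 1) = if i.succ ∈ x then 1 else 0 := has_val x i.succ

theorem has_eq_zero_or_one {n : ℕ} (x : Finset (Fin (n + 1))) (r : ℕ) :
    has x r = 0 ∨ has x r = 1 := by
  by_cases h : r < n + 1
  · have := has_val x ⟨r, h⟩
    simp only at this
    rw [this]
    split_ifs <;> simp
  · left
    exact Finset.sum_eq_zero fun j _ => if_neg (by omega)

theorem cnt_zero {n : ℕ} (x : Finset (Fin (n + 1))) : cnt x 0 = x.card := by simp [cnt]

theorem cnt_of_lt {n : ℕ} (x : Finset (Fin (n + 1))) {r : ℕ} (h : n < r) : cnt x r = 0 :=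
  Finset.sum_eq_zero fun j _ => if_neg (by omega)

theorem cnt_insert_erase {n : ℕ} {x : Finset (Fin (n + 1))} {a b : Fin (n + 1)} (ha : a ∈ x)
    (hb : b ∉ x) (r : ℕ) : cnt (insert b (x.erase a)) r =
      cnt x r - (if r ≤ a.val then 1 else 0) + (if r ≤ b.val then 1 else 0) := by
  rw [cnt, Finset.sum_insert (fun h => hb (Finset.mem_of_mem_erase h)), cnt,
    ← Finset.add_sum_erase _ _ ha]
  ring

variable {n k : ℕ}

/-- The difference of the numbers of dots of two states in region `r` or beyond. -/
def wt (x y : IState n k) (r : ℕ) : ℤ := cnt y.1 r - cnt x.1 r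

theorem relWeight_eq (x y : IState n k) (i : Fin n) : relWeight x y i = wt x y (i.val + 1) := by
  simp only [relWeight, wt, cnt, Finset.card_filter]
  push_cast
  simp only [Fin.le_def, Fin.val_succ]

theorem wt_self (x : IState n k) (r : ℕ) : wt x x r = 0 := sub_self _

theorem wt_add (x y z : IState n k) (r : ℕ) : wt x z r = wt x y r + wt y z r := by
  simp only [wt]; ring

theorem wt_symm (x y : IState n k) (r : ℕ) : wt y x r = -wt x y r := by
  simp only [wt]; ring

theorem wt_zero (x y : IState n k) : wt x y 0 = 0 := by
  rw [wt, cnt_zero, cnt_zero, x.2, y.2, sub_self]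

theorem wt_of_lt (x y : IState n k) {r : ℕ} (h : n < r) : wt x y r = 0 := by
  rw [wt, cnt_of_lt _ h, cnt_of_lt _ h, sub_self]

/-- The occupation of regions is the discrete derivative of `wt`. As both indicators lie in `{0,
1}`, `wt` jumps by at most one between consecutive regions, and a jump determines who occupies the
region. The combinatorial arguments below rest on this. -/
theorem wt_step (x y : IState n k) (r : ℕ) :
    wt x y r = wt x y (r + 1) + has y.1 r - has x.1 r := by
  rw [wt, wt, cnt_eq_add_has, cnt_eq_add_has x.1]; ring

theorem eq_of_wt_eq_zero {x y : IState n k} (h : ∀ r, wt x y r = 0) : x = y := by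
  refine Subtype.ext (Finset.ext fun j => ?_)
  have h1 := wt_step x y j.val
  rw [h, h, has_val, has_val] at h1
  by_cases hx : j ∈ x.1 <;> by_cases hy : j ∈ y.1 <;> simp [hx, hy] at h1 ⊢

/-- The label of a move of a dot across line `i`, rightwards if `s` holds and leftwards if not. -/
def mv {S : Finset (Fin n)} (s : Bool) (i : Fin n) : Label S := if s then .R i else .L i

/-- The sign of a direction. -/
def sgn (s : Bool) : ℤ := if s then 1 else -1

/-- A dot crossing line `i` changes only the number of dots in region `i + 1` or beyond. Conversely,
such a change of the counts fixes the change of each indicator, and indicators with values 0 and 1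
leave only one possibility. Set-theoretic conditions on moves thereby become linear arithmetic. -/
theorem joins_mv_iff {S : Finset (Fin n)} (s : Bool) (i : Fin n) (x y : IState n k) :
    (mv (S := S) s i).Joins x y ↔ ∀ r, wt x y r = if r = i.val + 1 then sgn s else 0 := by
  constructor
  · intro h r
    cases s
    · obtain ⟨h1, h2, h3⟩ := h
      rw [wt, h3, cnt_insert_erase h1 h2]
      simp only [Fin.val_succ, Fin.val_castSucc, sgn]
      split_ifs <;> first | omega | contradiction
    · obtain ⟨h1, h2, h3⟩ := h
      rw [wt, h3, cnt_insert_erase h1 h2]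
      simp only [Fin.val_succ, Fin.val_castSucc, sgn]
      split_ifs <;> omega
  · intro h
    -- Taking the discrete derivative: the indicator changes by `sgn s` at region `i + 1`, by the
    -- opposite at region `i`, and nowhere else.
    have key : ∀ r, has y.1 r = has x.1 r + (if r = i.val + 1 then sgn s else 0) -
        (if r = i.val then sgn s else 0) := by
      intro r
      have h1 := wt_step x y r
      rw [h, h] at h1
      simp only [add_left_inj] at h1
      omega
    have h1 := key i.val
    have h2 := key (i.val + 1)
    rw [has_castSucc, has_castSucc] at h1
    rw [has_succ, has_succ] at h2
    have hj : ∀ j : Fin (n + 1), j ≠ i.castSucc → j ≠ i.succ → (j ∈ y.1 ↔ j ∈ x.1) := by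
      intro j hj1 hj2
      have h3 := key j.val
      have e1 : j.val ≠ i.val := fun h => hj1 (Fin.ext h)
      have e2 : j.val ≠ i.val + 1 := fun h => hj2 (Fin.ext h)
      rw [if_neg e1, if_neg e2, has_val, has_val] at h3
      by_cases hx : j ∈ x.1 <;> by_cases hy : j ∈ y.1 <;> simp [hx, hy] at h3 ⊢
    have hne : i.castSucc ≠ i.succ := (Fin.castSucc_lt_succ (i := i)).ne
    cases s
    · simp only [sgn] at h1 h2
      have a1 : i.succ ∈ x.1 ∧ i.succ ∉ y.1 := by
        by_cases hx : i.succ ∈ x.1 <;> by_cases hy : i.succ ∈ y.1 <;> simp_all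
      have a2 : i.castSucc ∉ x.1 ∧ i.castSucc ∈ y.1 := by
        by_cases hx : i.castSucc ∈ x.1 <;> by_cases hy : i.castSucc ∈ y.1 <;> simp_all
      refine ⟨a1.1, a2.1, Finset.ext fun j => ?_⟩
      by_cases e1 : j = i.castSucc
      · subst e1; simp [a2.2]
      · by_cases e2 : j = i.succ
        · subst e2; simp [a1.2, hne.symm]
        · simp [e1, e2, hj j e1 e2]
    · simp only [sgn] at h1 h2
      have a1 : i.succ ∉ x.1 ∧ i.succ ∈ y.1 := by
        by_cases hx : i.succ ∈ x.1 <;> by_cases hy : i.succ ∈ y.1 <;> simp_all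
      have a2 : i.castSucc ∈ x.1 ∧ i.castSucc ∉ y.1 := by
        by_cases hx : i.castSucc ∈ x.1 <;> by_cases hy : i.castSucc ∈ y.1 <;> simp_all
      refine ⟨a2.1, a1.1, Finset.ext fun j => ?_⟩
      by_cases e1 : j = i.castSucc
      · subst e1; simp [a2.2, hne]
      · by_cases e2 : j = i.succ
        · subst e2; simp [a1.2]
        · simp [e1, e2, hj j e1 e2]

theorem joins_mv_symm {S : Finset (Fin n)} {s : Bool} {i : Fin n} {x y : IState n k}
    (h : (mv (S := S) s i).Joins x y) : (mv (S := S) (!s) i).Joins y x := by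
  rw [joins_mv_iff] at h ⊢
  intro r
  rw [wt_symm, h r]
  cases s <;> simp [sgn] <;> split_ifs <;> simp

theorem joins_mv_unique {S : Finset (Fin n)} {s : Bool} {i : Fin n} {w w' y : IState n k}
    (h : (mv (S := S) s i).Joins w y) (h' : (mv (S := S) s i).Joins w' y) : w = w' := by
  rw [joins_mv_iff] at h h'
  refine eq_of_wt_eq_zero fun r => ?_
  rw [wt_add w y w', wt_symm w' y, h, h']
  ring

/-- The occupation of the two regions next to a line after a move across it. -/
theorem has_of_joins {S : Finset (Fin n)} {s : Bool} {i : Fin n} {w y : IState n k}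
    (h : (mv (S := S) s i).Joins w y) :
    has y.1 i.val = (if s then 0 else 1) ∧ has y.1 (i.val + 1) = (if s then 1 else 0) := by
  rw [joins_mv_iff] at h
  have h1 := wt_step w y i.val
  have h2 := wt_step w y (i.val + 1)
  rw [h, h] at h1 h2
  simp only [add_left_inj, Nat.left_eq_add, Nat.succ_ne_self, if_true, if_false,
    one_ne_zero] at h1 h2
  have a1 := has_eq_zero_or_one w.1 i.val
  have a2 := has_eq_zero_or_one y.1 i.val
  have a3 := has_eq_zero_or_one w.1 (i.val + 1)
  have a4 := has_eq_zero_or_one y.1 (i.val + 1)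
  cases s <;> simp [sgn] at h1 h2 ⊢ <;> omega

theorem exists_joins {S : Finset (Fin n)} {s : Bool} {i : Fin n} {y : IState n k}
    (h1 : has y.1 i.val = (if s then 0 else 1))
    (h2 : has y.1 (i.val + 1) = (if s then 1 else 0)) :
    ∃ w : IState n k, (mv (S := S) s i).Joins w y := by
  -- The predecessor of `y` is found by performing the reverse move on `y`.
  suffices h : ∃ w : IState n k, (mv (S := S) (!s) i).Joins y w by
    obtain ⟨w, h⟩ := h
    have h' := joins_mv_symm h
    rw [Bool.not_not] at h'
    exact ⟨w, h'⟩
  have card : ∀ a b : Fin (n + 1), a ∈ y.1 → b ∉ y.1 → (insert b (y.1.erase a)).card = k := by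
    intro a b ha hb
    rw [Finset.card_insert_of_notMem (fun h => hb (Finset.mem_of_mem_erase h)),
      Finset.card_erase_add_one ha, y.2]
  rw [has_castSucc] at h1
  rw [has_succ] at h2
  cases s
  · have a1 : i.castSucc ∈ y.1 := by by_contra h; simp [h] at h1
    have a2 : i.succ ∉ y.1 := by intro h; simp [h] at h2
    exact ⟨⟨_, card _ _ a1 a2⟩, a1, a2, rfl⟩
  · have a1 : i.castSucc ∉ y.1 := by intro h; simp [h] at h1
    have a2 : i.succ ∈ y.1 := by by_contra h; simp [h] at h2
    exact ⟨⟨_, card _ _ a2 a1⟩, a2, a1, rfl⟩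

/-- Two different states are joined by a shortest sequence of moves; this is its last move. -/
theorem exists_last_move (S : Finset (Fin n)) {x y : IState n k} (hxy : x ≠ y) :
    ∃ (s : Bool) (i : Fin n) (w : IState n k), (mv (S := S) s i).Joins w y ∧
      0 < sgn s * wt x y (i.val + 1) := by
  obtain ⟨r, hr⟩ : ∃ r, wt x y r ≠ 0 := by
    by_contra! h
    exact hxy (eq_of_wt_eq_zero h)
  have le : ∀ r, wt x y r ≠ 0 → r ≤ n := fun r h => by
    by_contra h'
    exact h (wt_of_lt x y (by omega))
  rcases lt_or_gt_of_ne hr with hr | hr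
  -- Some weight is negative. At the first region `c + 1` of negative weight the drop from `c`
  -- forces `y` to occupy `c`. Among all such `c` the greatest one, `d`, is taken: if `y` also
  -- occupied `d + 1`, the weight at `d + 2` would still be negative, against maximality. So a dot
  -- can have come leftwards from `d + 1` to `d`.
  · have hex : ∃ r, wt x y r < 0 := ⟨r, hr⟩
    classical
    set b := Nat.find hex with hb
    have hb1 : wt x y b < 0 := Nat.find_spec hex
    have hb0 : b ≠ 0 := fun h => by rw [h, wt_zero] at hb1; omega
    obtain ⟨c, hc⟩ := Nat.exists_eq_succ_of_ne_zero hb0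
    rw [hc, Nat.succ_eq_add_one] at hb1
    have hc1 : 0 ≤ wt x y c := not_lt.1 (Nat.find_min hex (show c < Nat.find hex by omega))
    have hc2 : has y.1 c = 1 := by
      have := wt_step x y c
      have := has_eq_zero_or_one x.1 c
      have := has_eq_zero_or_one y.1 c
      omega
    let P : ℕ → Prop := fun c => wt x y (c + 1) < 0 ∧ has y.1 c = 1
    have hP : P c := ⟨hb1, hc2⟩
    have hle : ∀ c, P c → c ≤ n := fun c h => by have := le (c + 1) h.1.ne; omega
    obtain ⟨d1, d2⟩ : P (Nat.findGreatest P n) := Nat.findGreatest_spec (hle c hP) hP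
    have hd3 : ¬P (Nat.findGreatest P n + 1) := fun h => by
      have := Nat.le_findGreatest (hle _ h) h
      omega
    generalize Nat.findGreatest P n = d at d1 d2 hd3
    have hdn := le _ d1.ne
    have h0 : has y.1 (d + 1) = 0 := by
      rcases has_eq_zero_or_one y.1 (d + 1) with h | h
      · exact h
      · refine absurd ⟨?_, h⟩ hd3
        have := wt_step x y (d + 1)
        have := has_eq_zero_or_one x.1 (d + 1)
        omega
    obtain ⟨w, hw⟩ := exists_joins (S := S) (s := false) (i := ⟨d, by omega⟩) (y := y) (by simpa)
      (by simpa)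
    exact ⟨false, _, w, hw, by simpa [sgn] using d1⟩
  -- The mirror image for a positive weight. At the last region `b` of positive weight `y` has a
  -- dot. The least occupied region `d` of positive weight has a free region below it, since
  -- otherwise the weight at `d - 1` would be positive too. So a dot can have come rightwards from
  -- `d - 1` to `d`.
  · let Q : ℕ → Prop := fun r => 0 < wt x y r
    classical
    have hQ : Q r := hr
    have hle : ∀ r, Q r → r ≤ n := fun r h => le r (ne_of_gt h)
    have b1 : Q (Nat.findGreatest Q n) := Nat.findGreatest_spec (hle r hQ) hQ
    have b2 : ¬Q (Nat.findGreatest Q n + 1) := fun h => by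
      have := Nat.le_findGreatest (hle _ h) h
      omega
    generalize Nat.findGreatest Q n = b at b1 b2
    have b3 : has y.1 b = 1 := by
      have := wt_step x y b
      have := has_eq_zero_or_one x.1 b
      have := has_eq_zero_or_one y.1 b
      simp only [Q] at b1 b2
      omega
    have hex : ∃ r, 0 < wt x y r ∧ has y.1 r = 1 := ⟨b, b1, b3⟩
    obtain ⟨d1, d2⟩ := Nat.find_spec hex
    have d3 : ∀ c < Nat.find hex, _ := fun c => Nat.find_min hex
    generalize Nat.find hex = d at d1 d2 d3
    have hd0 : d ≠ 0 := fun h => by rw [h, wt_zero] at d1; omega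
    obtain ⟨c, rfl⟩ := Nat.exists_eq_succ_of_ne_zero hd0
    rw [Nat.succ_eq_add_one] at d1 d2
    have hdn := le _ (ne_of_gt d1)
    have h0 : has y.1 c = 0 := by
      rcases has_eq_zero_or_one y.1 c with h | h
      · exact h
      · refine absurd ⟨?_, h⟩ (d3 c (Nat.lt_succ_self c))
        have := wt_step x y c
        have := has_eq_zero_or_one x.1 c
        omega
    obtain ⟨w, hw⟩ := exists_joins (S := S) (s := true) (i := ⟨c, by omega⟩) (y := y) (by simpa)
      (by simpa)
    exact ⟨true, _, w, hw, by simpa [sgn] using d1⟩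

/-! ### Distances between states -/

/-- The number of moves needed to get from one state to another. -/
def dist (x y : IState n k) : ℕ := ∑ i : Fin n, (wt x y (i.val + 1)).natAbs

theorem wt_of_joins {S : Finset (Fin n)} {s : Bool} {i : Fin n} {w y : IState n k}
    (h : (mv (S := S) s i).Joins w y) (x : IState n k) (r : ℕ) :
    wt x y r = wt x w r + if r = i.val + 1 then sgn s else 0 := by
  rw [wt_add x w y, (joins_mv_iff s i w y).1 h]

theorem sgn_eq (s : Bool) : sgn s = 1 ∨ sgn s = -1 := by cases s <;> simp [sgn]

theorem dist_of_joins {S : Finset (Fin n)} {s : Bool} {i : Fin n} {w y : IState n k}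
    (h : (mv (S := S) s i).Joins w y) {x : IState n k} (hx : 0 < sgn s * wt x y (i.val + 1)) :
    dist x y = dist x w + 1 := by
  have h1 : dist x w + 1 = dist x w + ∑ j : Fin n, if j = i then 1 else 0 := by simp
  rw [h1, dist, dist, ← Finset.sum_add_distrib]
  refine Finset.sum_congr rfl fun j _ => ?_
  rw [wt_of_joins h x] at hx ⊢
  by_cases hj : j = i
  · subst hj
    simp only [if_true] at hx ⊢
    rcases sgn_eq s with e | e <;> rw [e] at hx ⊢ <;> omega
  · rw [if_neg hj, if_neg (fun h => hj (Fin.ext (by omega))), add_zero, add_zero]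

/-! ### The structure constants of `B_0(n,k)` -/

theorem structMonomial_eq (x y z : IState n k) : structMonomial x y z =
    ∏ i : Fin n, MvPolynomial.X i ^ ((|wt y z (i.val + 1)| - |wt x z (i.val + 1)| +
      |wt x y (i.val + 1)|) / 2).toNat := by
  simp only [structMonomial, absWeight, relWeight_eq]

theorem structMonomial_self (x y : IState n k) : structMonomial x y y = 1 := by
  rw [structMonomial_eq]
  exact Finset.prod_eq_one fun i _ => by simp [wt_self]

/-- The power of `U_i` that comes from appending to `f_{x,w}` a move to `y` across line `i` in
direction `s`: the move either leads away from `x` or back. -/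
def turn (s : Bool) (i : Fin n) (x y : IState n k) : Poly n :=
  if 0 < sgn s * wt x y (i.val + 1) then 1 else MvPolynomial.X i

/-- Here `b`, `a`, `a + σ` are the weights on one line from `x` to `y`, from `y` to `w` and from `y`
to `z`. The last step increases `|a|` by one, and changes `|b + a|` by one up or down according to
whether it leads away from `x`. Half of the excess in the triangle inequality therefore grows by 0
or by 1. -/
theorem half_excess_step {σ a b : ℤ} (hσ : σ = 1 ∨ σ = -1) (h : 0 < σ * (a + σ)) :
    ((|a + σ| - |b + (a + σ)| + |b|) / 2).toNat =
      (if 0 < σ * (b + (a + σ)) then 0 else 1) + ((|a| - |b + a| + |b|) / 2).toNat := by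
  simp only [Int.abs_eq_natAbs]
  rcases hσ with rfl | rfl <;> split_ifs <;> omega

/-- Recursion for the structure constants along a shortest path from `y`: only the exponent on line
`i` can change, by `half_excess_step`. -/
theorem structMonomial_step {S : Finset (Fin n)} {s : Bool} {i : Fin n} {w z : IState n k}
    (h : (mv (S := S) s i).Joins w z) (x y : IState n k)
    (hy : 0 < sgn s * wt y z (i.val + 1)) :
    structMonomial x y z = turn s i x z * structMonomial x y w := by
  have h1 : turn s i x z = ∏ j : Fin n, if j = i then turn s i x z else 1 := by simp
  rw [h1, structMonomial_eq, structMonomial_eq, ← Finset.prod_mul_distrib]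
  refine Finset.prod_congr rfl fun j _ => ?_
  have hw := (joins_mv_iff s i w z).1 h
  by_cases hj : j = i
  · subst hj
    rw [if_pos rfl, turn, wt_add x y z, wt_add y w z, wt_add x y w, hw, if_pos rfl]
    rw [wt_add y w z, hw, if_pos rfl] at hy
    rw [half_excess_step (sgn_eq s) hy, pow_add]
    split_ifs <;> simp
  · rw [if_neg hj, one_mul, wt_add x w z, wt_add y w z, hw,
      if_neg (fun h => hj (Fin.ext (by omega))), add_zero, add_zero]

end

section

/-! ### Shortest paths in the quiver algebra -/

namespace GS

variable {n k : ℕ} {S : Finset (Fin n)}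

/-- The arrow given by a move of a dot. -/
def mvArrow {s : Bool} {i : Fin n} {x y : GVert k S} (h : (mv (S := S) s i).Joins x.state y.state) :
    x ⟶ y := ⟨mv s i, h⟩

theorem ofArrow_mul_ofArrow {x y z : GVert k S} (e : x ⟶ y) (e' : y ⟶ z) :
    ofArrow e * ofArrow e' = ofPath ((Quiver.Path.nil.cons e).cons e') := by
  rw [ofPath_cons]
  rfl

theorem mvArrow_mul_back {s : Bool} {i : Fin n} {x y : GVert k S}
    (h : (mv (S := S) s i).Joins x.state y.state)
    (h' : (mv (S := S) (!s) i).Joins y.state x.state) :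
    ofArrow (mvArrow h) * ofArrow (mvArrow h') = ofPath (uLoop i x) := by
  rw [ofArrow_mul_ofArrow]
  refine ofPath_eq ?_
  cases s
  · exact WordEq.l_r i
  · exact WordEq.r_l i

theorem mvArrow_comm {s t : Bool} {i j : Fin n} (hij : 1 < |(i.val : ℤ) - j.val|)
    {x y y' z : GVert k S} (h1 : (mv (S := S) s i).Joins x.state y.state)
    (h2 : (mv (S := S) t j).Joins y.state z.state)
    (h3 : (mv (S := S) t j).Joins x.state y'.state)
    (h4 : (mv (S := S) s i).Joins y'.state z.state) :
    ofArrow (mvArrow h1) * ofArrow (mvArrow h2) =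
      ofArrow (mvArrow h3) * ofArrow (mvArrow h4) := by
  rw [ofArrow_mul_ofArrow, ofArrow_mul_ofArrow]
  cases s <;> cases t
  · exact ofPath_eq (WordEq.l_l i j hij)
  · exact (ofPath_eq (WordEq.r_l_far j i (by rwa [abs_sub_comm]))).symm
  · exact ofPath_eq (WordEq.r_l_far i j hij)
  · exact ofPath_eq (WordEq.r_r i j hij)

/-- `a` is the class of a path of moves from `x` to `y`, each of which leads away from `x`. -/
inductive Geodesic (x : GVert k S) : GVert k S → GS k S → Prop
  | nil : Geodesic x x (idem x)
  | cons {w y : GVert k S} {a : GS k S} {s : Bool} {i : Fin n}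
      (h : (mv (S := S) s i).Joins w.state y.state)
      (away : 0 < sgn s * wt x.state y.state (i.val + 1)) (ha : Geodesic x w a) :
      Geodesic x y (a * ofArrow (mvArrow h))

theorem exists_geodesic (x y : GVert k S) : ∃ a, Geodesic x y a := by
  induction hd : dist x.state y.state using Nat.strong_induction_on generalizing y with
  | _ d ih =>
    by_cases hxy : x.state = y.state
    · obtain rfl : x = y := hxy
      exact ⟨_, Geodesic.nil⟩
    · obtain ⟨s, i, w, h, away⟩ := exists_last_move S hxy
      obtain ⟨a, ha⟩ := ih _ (by rw [← hd, dist_of_joins h away]; exact Nat.lt_succ_self _)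
        (show GVert k S from w) rfl
      exact ⟨_, Geodesic.cons h away ha⟩

/-- Both moves touch the region between the two adjacent lines, so they either both enter it or both
leave it, in opposite directions. Leading away from `x` then requires weights of opposite signs at
consecutive regions, a jump of at least two, whereas `wt` jumps by at most one. -/
theorem not_adjacent {s t : Bool} {i j : Fin n} {x y w w' : IState n k}
    (h : (mv (S := S) s i).Joins w y) (away : 0 < sgn s * wt x y (i.val + 1))
    (h' : (mv (S := S) t j).Joins w' y) (away' : 0 < sgn t * wt x y (j.val + 1)) :
    j.val ≠ i.val + 1 := by
  intro hj
  have a := has_of_joins h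
  have b := has_of_joins h'
  rw [hj] at b away'
  have c := wt_step x y (i.val + 1)
  have e := has_eq_zero_or_one x.1 (i.val + 1)
  cases s <;> cases t <;> simp [sgn] at a b away away' <;> omega

/-- Far apart lines have no region in common, so the move across line `j` can also be undone at `w`;
its result completes the commuting square. -/
theorem exists_square {s t : Bool} {i j : Fin n} (hij : 1 < |(i.val : ℤ) - j.val|)
    {y w w' : IState n k} (h : (mv (S := S) s i).Joins w y) (h' : (mv (S := S) t j).Joins w' y) :
    ∃ v : IState n k, (mv (S := S) t j).Joins v w ∧ (mv (S := S) s i).Joins v w' := by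
  have hij' : i.val + 1 < j.val ∨ j.val + 1 < i.val := by
    rcases lt_abs.1 hij with h | h <;> omega
  have hh := (joins_mv_iff s i w y).1 h
  have hh' := (joins_mv_iff t j w' y).1 h'
  have b := has_of_joins h'
  have same : ∀ r, r ≠ i.val → r ≠ i.val + 1 → has w.1 r = has y.1 r := by
    intro r h1 h2
    have h3 := wt_step w y r
    rw [hh, hh, if_neg h2, if_neg (by omega)] at h3
    omega
  obtain ⟨v, hv⟩ := exists_joins (S := S) (s := t) (i := j) (y := w)
    (by rw [same _ (by omega) (by omega), b.1]) (by rw [same _ (by omega) (by omega), b.2])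
  refine ⟨v, hv, (joins_mv_iff s i v w').2 fun r => ?_⟩
  rw [wt_add v y w', wt_add v w y, (joins_mv_iff t j v w).1 hv, hh, wt_symm w' y, hh']
  ring

/-- Confluence by induction on the distance. If the last moves agree, the shorter paths are
compared. Otherwise the moves are across lines far apart, and both paths are compared with paths
through the opposite corner of a square, where the far commutation relation applies. -/
theorem Geodesic.unique {x y : GVert k S} {a b : GS k S} (ha : Geodesic x y a)
    (hb : Geodesic x y b) : a = b := by
  induction hd : dist x.state y.state using Nat.strong_induction_on generalizing y a b with
  | _ d ih =>
    -- No move that ends at `x` leads away from `x`, so only the trivial path is a shortest path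
    -- from `x` to `x`.
    have self : ∀ {s : Bool} {i : Fin n}, ¬0 < sgn s * wt x.state x.state (i.val + 1) := by
      intro s i
      rw [wt_self, mul_zero]
      exact lt_irrefl 0
    cases ha with
    | nil =>
      cases hb with
      | nil => rfl
      | cons _ away _ => exact absurd away self
    | @cons w _ a s i h away ha =>
      cases hb with
      | nil => exact absurd away self
      | @cons w' _ b t j h' away' hb =>
        have hdw : dist x.state w.state < d := by rw [← hd, dist_of_joins h away]; omega
        have hdw' : dist x.state w'.state < d := by rw [← hd, dist_of_joins h' away']; omega
        by_cases hij : i = j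
        · subst hij
          obtain rfl : s = t := by
            cases s <;> cases t <;> simp [sgn] at away away' ⊢ <;> omega
          obtain rfl : w = w' := joins_mv_unique h h'
          rw [ih _ hdw ha hb rfl]
        · have n1 := not_adjacent h away h' away'
          have n2 := not_adjacent h' away' h away
          have far : 1 < |(i.val : ℤ) - j.val| := by
            have : i.val ≠ j.val := fun h => hij (Fin.ext h)
            rw [lt_abs]
            omega
          obtain ⟨v, hv, hv'⟩ := exists_square far h h'
          obtain ⟨c, hc⟩ := exists_geodesic x (show GVert k S from v)
          -- The move across line `i` does not affect the weight on line `j`, and conversely. So the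
          -- moves from `v` still lead away from `x`, and a shortest path to `v` extends to shortest
          -- paths to `w` and to `w'`.
          have e1 : wt x.state w.state (j.val + 1) = wt x.state y.state (j.val + 1) := by
            rw [wt_of_joins h x.state, if_neg (by omega), add_zero]
          have e2 : wt x.state w'.state (i.val + 1) = wt x.state y.state (i.val + 1) := by
            rw [wt_of_joins h' x.state, if_neg (by omega), add_zero]
          have g1 : Geodesic x w _ := Geodesic.cons hv (by rwa [e1]) hc
          have g2 : Geodesic x w' _ := Geodesic.cons hv' (by rwa [e2]) hc
          rw [ih _ hdw ha g1 rfl, ih _ hdw' hb g2 rfl, mul_assoc, mul_assoc,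
            mvArrow_comm (by rwa [abs_sub_comm]) hv h hv' h']

/-- The class of the shortest paths from `x` to `y`. -/
def geo (x y : GVert k S) : GS k S := (exists_geodesic x y).choose

theorem geodesic_geo (x y : GVert k S) : Geodesic x y (geo x y) :=
  (exists_geodesic x y).choose_spec

theorem geo_self (x : GVert k S) : geo x x = idem x := (geodesic_geo x x).unique .nil

theorem geo_mul_away {s : Bool} {i : Fin n} {x w y : GVert k S}
    (h : (mv (S := S) s i).Joins w.state y.state)
    (away : 0 < sgn s * wt x.state y.state (i.val + 1)) :
    geo x w * ofArrow (mvArrow h) = geo x y :=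
  (Geodesic.cons h away (geodesic_geo x w)).unique (geodesic_geo x y)

theorem geo_arrow {s : Bool} {i : Fin n} {x y : GVert k S}
    (h : (mv (S := S) s i).Joins x.state y.state) : geo x y = ofArrow (mvArrow h) := by
  rw [← geo_mul_away h, geo_self]
  · exact idem_mul_ofPath _
  · rw [(joins_mv_iff s i x.state y.state).1 h, if_pos rfl]
    cases s <;> simp [sgn]

theorem Geodesic.mul_uLoop {x y : GVert k S} {a : GS k S} (ha : Geodesic x y a) (i : Fin n) :
    a * ofPath (uLoop i y) = U i * a := by
  rw [U_comm]
  cases ha with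
  | nil =>
    rw [← ofPath_nil, ofPath_mul_uLoop, U_comm]
  | @cons w _ a s j h away ha =>
    rw [mul_assoc, mul_assoc, ofArrow, ofPath_mul_uLoop, U_comm]

theorem Geodesic.mul_idem {x y : GVert k S} {a : GS k S} (ha : Geodesic x y a) :
    a * idem y = a := by
  cases ha with
  | nil => exact complete_idem.idem x
  | cons h away ha => rw [mul_assoc, ofArrow, ofPath_mul_idem]

theorem Geodesic.idem_mul {x y : GVert k S} {a : GS k S} (ha : Geodesic x y a) :
    idem x * a = a := by
  induction ha with
  | nil => exact complete_idem.idem x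
  | cons h away ha ih => rw [← mul_assoc, ih]

/-- If the move leads away from `x`, it prolongs the shortest path. If not, the reverse move from
`y` to `w` leads away from `x`, so by uniqueness the shortest path to `w` may be taken to end with
it; that arrow and the new one multiply to a `U_i`-loop. -/
theorem geo_mul_arrow {s : Bool} {i : Fin n} (x : GVert k S) {w y : GVert k S}
    (h : (mv (S := S) s i).Joins w.state y.state) :
    geo x w * ofArrow (mvArrow h) = uPoly k S (turn s i x.state y.state) * geo x y := by
  rw [turn]
  split_ifs with away
  · rw [map_one, one_mul, geo_mul_away h away]
  · have h' := joins_mv_symm h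
    have away' : 0 < sgn (!s) * wt x.state w.state (i.val + 1) := by
      rw [wt_of_joins h x.state, if_pos rfl] at away
      cases s <;> simp [sgn] at away ⊢ <;> omega
    rw [← geo_mul_away h' away', mul_assoc]
    have hs := mvArrow_mul_back (s := !s) h' (by rwa [Bool.not_not])
    have hb : (mv (S := S) (!!s) i).Joins w.state y.state := by rwa [Bool.not_not]
    have e : ofArrow (mvArrow hb) = ofArrow (mvArrow h) := by
      congr 2
      simp
    rw [e] at hs
    rw [hs, uPoly_X, (geodesic_geo x y).mul_uLoop]

/-- The arrows of a shortest path from `y` to `z` are appended one by one. Each contributes its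
`turn` relative to `x`, and these factors build up the structure monomial by `structMonomial_step`.
-/
theorem geo_mul_geo (x y z : GVert k S) :
    geo x y * geo y z = uPoly k S (structMonomial x.state y.state z.state) * geo x z := by
  generalize hg : geo y z = g
  have hG : Geodesic y z g := hg ▸ geodesic_geo y z
  clear hg
  induction hG with
  | nil =>
    rw [structMonomial_self, map_one, one_mul, (geodesic_geo x y).mul_idem]
  | @cons w z a s i h away ha ih =>
    rw [← mul_assoc, ih, mul_assoc, geo_mul_arrow x h,
      structMonomial_step h x.state y.state away, map_mul, ← mul_assoc,
      uPoly_comm (structMonomial _ _ _)]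

end GS

end

section

/-! ### Products in `B_0(n,k)` and in `B(n,k,S)` -/

variable {n k : ℕ}

namespace B0

theorem f_self (x : IState n k) : f x x = idem x := by
  have h := quotMap_eq_zero (R := kRel n k) (Or.inl ⟨x, rfl⟩)
  rwa [map_sub, sub_eq_zero] at h

theorem f_mul_f (x y z : IState n k) : f x y * f y z = structMonomial x y z • f x z := by
  have h := quotMap_eq_zero (R := kRel n k) (Or.inr ⟨x, y, z, rfl⟩)
  rw [map_sub, sub_eq_zero, map_mul] at h
  exact h

theorem idem_mul_f (w x y : IState n k) : idem w * f x y = if w = x then f x y else 0 := by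
  have h : PathAlg.idem (show KVert n k from w) * kEdge (show KVert n k from x) y =
      if w = x then kEdge (show KVert n k from x) y else 0 := PathAlg.idem_mul_ofPath _ _
  have h' := congrArg (quotMap (kRel n k)) h
  rw [map_mul] at h'
  refine h'.trans ?_
  split_ifs
  · rfl
  · exact map_zero _

theorem f_mul_idem (w x y : IState n k) : f x y * idem w = if w = y then f x y else 0 := by
  have h : kEdge (show KVert n k from x) y * PathAlg.idem (show KVert n k from w) =
      if w = y then kEdge (show KVert n k from x) y else 0 := PathAlg.ofPath_mul_idem _ _
  have h' := congrArg (quotMap (kRel n k)) h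
  rw [map_mul] at h'
  refine h'.trans ?_
  split_ifs
  · rfl
  · exact map_zero _

open Classical in
/-- The sum of all `f_{x,y}` for which `y` arises from `x` by a move across line `i`. -/
def move (k : ℕ) (s : Bool) (i : Fin n) : B0 n k :=
  ∑ x : IState n k, ∑ y : IState n k,
    if (mv (S := (∅ : Finset (Fin n))) s i).Joins x y then f x y else 0

theorem idem_mul_move {s : Bool} {i : Fin n} {x y : IState n k}
    (h : (mv (S := (∅ : Finset (Fin n))) s i).Joins x y) : idem x * move k s i = f x y := by
  rw [move, Finset.mul_sum, Finset.sum_eq_single x, Finset.mul_sum, Finset.sum_eq_single y]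
  · rw [if_pos h, idem_mul_f, if_pos rfl]
  · intro y' _ hy
    rw [if_neg, mul_zero]
    intro h'
    exact hy (joins_mv_unique (joins_mv_symm h') (joins_mv_symm h))
  · simp
  · intro x' _ hx
    rw [Finset.mul_sum]
    refine Finset.sum_eq_zero fun y' _ => ?_
    split_ifs
    · rw [idem_mul_f, if_neg (Ne.symm hx)]
    · rw [mul_zero]
  · simp

theorem move_mul_idem {s : Bool} {i : Fin n} {x y : IState n k}
    (h : (mv (S := (∅ : Finset (Fin n))) s i).Joins x y) : move k s i * idem y = f x y := by
  rw [move, Finset.sum_mul, Finset.sum_eq_single x, Finset.sum_mul, Finset.sum_eq_single y]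
  · rw [if_pos h, f_mul_idem, if_pos rfl]
  · intro y' _ hy
    split_ifs
    · rw [f_mul_idem, if_neg (Ne.symm hy)]
    · rw [zero_mul]
  · simp
  · intro x' _ hx
    rw [Finset.sum_mul]
    refine Finset.sum_eq_zero fun y' _ => ?_
    split_ifs with h'
    · rw [f_mul_idem, if_neg]
      rintro rfl
      exact hx (joins_mv_unique h' h)
    · rw [zero_mul]
  · simp

theorem idem_mul_U (x : IState n k) (i : Fin n) :
    idem x * U k i = (MvPolynomial.X i : Poly n) • idem x := by
  rw [U, Finset.mul_sum, Finset.sum_eq_single x]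
  · rw [mul_smul_comm, idem_mul_f, if_pos rfl, f_self]
  · intro y _ hy
    rw [mul_smul_comm, idem_mul_f, if_neg (Ne.symm hy), smul_zero]
  · simp

end B0

namespace BS

variable {S : Finset (Fin n)}

/-- The canonical map from `B_0(n,k)` to `B(n,k,S)`. -/
def incl (k : ℕ) (S : Finset (Fin n)) : B0 n k →+* BS k S :=
  (Algebra.TensorProduct.includeLeftRingHom : B n k →+* BS k S).comp (quotMap (bRel n k))

theorem mul_assoc' (a b c : BS k S) : a * b * c = a * (b * c) := mul_assoc a b c

/-- The structure map on coefficients that are the same at all states. -/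
def scalar (k : ℕ) (S : Finset (Fin n)) : Poly n →+* BS k S :=
  (Algebra.TensorProduct.includeLeftRingHom : B n k →+* BS k S).comp (algebraMap (Poly n) (B n k))

theorem scalar_mul (c : Poly n) (a : BS k S) : scalar k S c * a = c • a := by
  induction a using TensorProduct.induction_on with
  | zero => simp
  | add a b ha hb => rw [mul_add, smul_add, ha, hb]
  | tmul b e =>
    have h : scalar k S c = TensorProduct.tmul (Poly n) (algebraMap (Poly n) (B n k) c) 1 := rfl
    rw [h, Algebra.TensorProduct.tmul_mul_tmul, one_mul, ← Algebra.smul_def]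
    rfl

theorem structHom_apply (c : IState n k → Poly n) :
    structHom k S c = ∑ x : IState n k, scalar k S (c x) * idem S x := rfl

theorem incl_smul (c : Poly n) (a : B0 n k) : incl k S (c • a) = c • incl k S a := rfl

theorem incl_eq_zero {a : B0 n k} (h : a ∈ bRel n k) : incl k S a = 0 := by
  rw [incl, RingHom.comp_apply, quotMap_eq_zero h, map_zero]

theorem f_self (x : IState n k) : f S x x = idem S x := congrArg (incl k S) (B0.f_self x)

theorem f_mul_f (x y z : IState n k) :
    f S x y * f S y z = structMonomial x y z • f S x z := by
  have h := congrArg (incl k S) (B0.f_mul_f x y z)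
  rwa [map_mul, incl_smul] at h

theorem idem_mul_f (x y : IState n k) : idem S x * f S x y = f S x y := by
  have h := congrArg (incl k S) (B0.idem_mul_f x x y)
  rwa [map_mul, if_pos rfl] at h

theorem f_mul_idem (x y : IState n k) : f S x y * idem S y = f S x y := by
  have h := congrArg (incl k S) (B0.f_mul_idem y x y)
  rwa [map_mul, if_pos rfl] at h

theorem idem_mul_idem (x : IState n k) : idem S x * idem S x = idem S x :=
  (complete_idem k S).idem x

/-- This is `structMonomial_step` with both intermediate states equal to `w`: a single move always
leads away from its source. -/
theorem f_mul_f_of_joins {S' : Finset (Fin n)} {s : Bool} {i : Fin n} (x : IState n k)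
    {w y : IState n k} (h : (mv (S := S') s i).Joins w y) :
    f S x w * f S w y = turn s i x y • f S x y := by
  rw [f_mul_f, structMonomial_step h x w, structMonomial_self, mul_one]
  rw [(joins_mv_iff s i w y).1 h, if_pos rfl]
  cases s <;> simp [sgn]

/-- The relations of `B(n,k)` are stated for sums over all states; multiplying by the idempotents at
`x` and `z` isolates one summand. -/
theorem f_mul_f_eq_zero {s : Bool} {i j : Fin n} (hij : B0.move k s i * B0.move k s j ∈ bRel n k)
    {x y z : IState n k} (h : (mv (S := S) s i).Joins x y) (h' : (mv (S := S) s j).Joins y z) :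
    f S x y * f S y z = 0 := by
  have e : f S x y * f S y z = incl k S
      (B0.idem x * (B0.move k s i * B0.move k s j) * B0.idem z) := by
    -- The set `S` enters a move only through the type of its label, so the condition is the same
    -- for every `S`.
    have h1 : (mv (S := (∅ : Finset (Fin n))) s i).Joins x y := by cases s <;> exact h
    have h2 : (mv (S := (∅ : Finset (Fin n))) s j).Joins y z := by cases s <;> exact h'
    rw [mul_assoc, mul_assoc, B0.move_mul_idem h2, ← mul_assoc, B0.idem_mul_move h1, map_mul]
    rfl
  rw [e, map_mul, map_mul, incl_eq_zero hij, mul_zero, zero_mul]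

theorem smul_idem_eq_zero {x : IState n k} {i : Fin n} (h : i.castSucc ∉ x.1)
    (h' : i.succ ∉ x.1) : (MvPolynomial.X i : Poly n) • idem S x = 0 := by
  have e := incl_eq_zero (S := S) (Or.inr ⟨x, i, h, h', rfl⟩)
  rwa [B0.idem_mul_U, incl_smul] at e

theorem ext_add_self (e : Ext S) : e + e = 0 := by
  have h : ((1 + 1 : Poly n)) • e = 0 := by rw [CharTwo.add_self_eq_zero, zero_smul]
  rwa [add_smul, one_smul] at h

/-- In characteristic two anticommuting elements commute, so the exterior algebra is commutative. -/
theorem ext_ι_comm (v : S → Poly n) (e : Ext S) :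
    ExteriorAlgebra.ι (Poly n) v * e = e * ExteriorAlgebra.ι (Poly n) v := by
  induction e using ExteriorAlgebra.induction with
  | algebraMap r => exact (Algebra.commutes r _).symm
  | ι w =>
    have h1 := ExteriorAlgebra.ι_add_mul_swap (R := Poly n) v w
    have h2 := ext_add_self (ExteriorAlgebra.ι (Poly n) w * ExteriorAlgebra.ι (Poly n) v)
    exact (add_right_cancel (h1.trans h2.symm))
  | mul a b ha hb => rw [← mul_assoc, ha, mul_assoc, hb, mul_assoc]
  | add a b ha hb => rw [mul_add, add_mul, ha, hb]

theorem C_comm (i : S) (a : BS k S) : C k i * a = a * C k i := by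
  induction a using TensorProduct.induction_on with
  | zero => simp
  | add a b ha hb => rw [mul_add, add_mul, ha, hb]
  | tmul b e =>
    rw [C, Algebra.TensorProduct.tmul_mul_tmul, Algebra.TensorProduct.tmul_mul_tmul, one_mul,
      mul_one, extC, ext_ι_comm]

theorem C_mul_self (i : S) : C k i * C k i = 0 := by
  rw [C, Algebra.TensorProduct.tmul_mul_tmul, extC, ExteriorAlgebra.ι_sq_zero,
    TensorProduct.tmul_zero]

theorem idem_mul_arrowImage {x y : IState n k} {ℓ : Label S} (h : ℓ.Joins x y) :
    idem S x * arrowImage x y ℓ = arrowImage x y ℓ := by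
  cases ℓ with
  | R i => exact idem_mul_f x y
  | L i => exact idem_mul_f x y
  | U i => rw [arrowImage, mul_smul_comm, idem_mul_idem]
  | C i => rw [arrowImage, ← mul_assoc', ← C_comm, mul_assoc', idem_mul_idem]

theorem arrowImage_mul_idem {x y : IState n k} {ℓ : Label S} (h : ℓ.Joins x y) :
    arrowImage x y ℓ * idem S y = arrowImage x y ℓ := by
  cases ℓ with
  | R i => exact f_mul_idem x y
  | L i => exact f_mul_idem x y
  | U i =>
    obtain rfl : x = y := h
    rw [arrowImage, smul_mul_assoc, idem_mul_idem]
  | C i =>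
    obtain rfl : x = y := h
    rw [arrowImage, mul_assoc', idem_mul_idem]

theorem arrowImage_mv (s : Bool) (i : Fin n) (x y : IState n k) :
    arrowImage x y (mv (S := S) s i) = f S x y := by
  cases s <;> rfl

theorem arrowImage_U_comm {ℓ : Label S} (i : Fin n) {x x' y y' : IState n k} (h : ℓ.Joins x y')
    (h' : ℓ.Joins x' y) (hx : x = x') (hy : y' = y) :
    arrowImage x y' ℓ * arrowImage y' y (.U i) = arrowImage x x' (.U i) * arrowImage x' y ℓ := by
  subst hx hy
  rw [arrowImage, arrowImage, mul_smul_comm, smul_mul_assoc, arrowImage_mul_idem h,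
    idem_mul_arrowImage h]

theorem f_back {s : Bool} {i : Fin n} {x y z : IState n k} (hz : (mv (S := S) (!s) i).Joins y z)
    (hxz : x = z) :
    f S x y * f S y z = (MvPolynomial.X i : Poly n) • idem S x := by
  subst hxz
  rw [f_mul_f_of_joins x hz, turn, wt_self, mul_zero, if_neg (lt_irrefl _), f_self]

/-- The first move does not affect line `j`, so the second leads away from `x` and no power of `U_j`
appears. The product depends only on the end points, which gives the far commutation relations. -/
theorem f_mul_f_of_far {s t : Bool} {i j : Fin n} (hij : 1 < |(i.val : ℤ) - j.val|)
    {x y z : IState n k} (hy : (mv (S := S) s i).Joins x y) (hz : (mv (S := S) t j).Joins y z) :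
    f S x y * f S y z = f S x z := by
  have hne : j.val + 1 ≠ i.val + 1 := by
    intro h
    rw [show i.val = j.val by omega, sub_self, abs_zero] at hij
    omega
  rw [f_mul_f_of_joins x hz, turn, if_pos, one_smul]
  rw [wt_add x y z, (joins_mv_iff _ _ _ _).1 hy, (joins_mv_iff _ _ _ _).1 hz, if_neg hne,
    if_pos rfl]
  cases t <;> simp [sgn]

end BS

/-! ### The homomorphism from the quiver algebra to `B(n,k,S)` -/

namespace GS

variable {S : Finset (Fin n)}

/-- The representation of `Γ(n,k,S)` in `B(n,k,S)`. -/
def rep (k : ℕ) (S : Finset (Fin n)) : QuiverRep (GVert k S) (BS k S) where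
  vert x := BS.idem S x.state
  arrow {x y} e := arrowImage x.state y.state (arrowLabel e)
  complete := BS.complete_idem k S
  vert_mul_arrow e := BS.idem_mul_arrowImage e.2
  arrow_mul_vert e := BS.arrowImage_mul_idem e.2

theorem rep_path_two {x y : GVert k S} (p : Quiver.Path x y) {a b : Label S}
    (h : word p = [a, b]) : ∃ z : IState n k, a.Joins x.state z ∧ b.Joins z y.state ∧
      (rep k S).path p = arrowImage x.state z a * arrowImage z y.state b := by
  obtain ⟨z, e, e', rfl, rfl, rfl⟩ := exists_arrows p h
  exact ⟨z.state, e.2, e'.2, by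
    rw [QuiverRep.path_comp, QuiverRep.path_toPath, QuiverRep.path_toPath]; rfl⟩

theorem rep_path_one {x y : GVert k S} (p : Quiver.Path x y) {a : Label S}
    (h : word p = [a]) :
    a.Joins x.state y.state ∧ (rep k S).path p = arrowImage x.state y.state a := by
  cases p with
  | nil => simp [word] at h
  | cons p e =>
    cases p with
    | nil =>
      simp only [word, List.nil_append, List.cons.injEq, and_true] at h
      subst h
      exact ⟨e.2, (rep k S).path_toPath e⟩
    | cons p e' =>
      have h' := congrArg List.length h
      simp [word] at h'

/-- Three kinds of relations occur: two moves across lines far apart, a move followed by its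
reverse, and a central loop passing another arrow. -/
theorem rep_wordEq {x y : GVert k S} {p q : Quiver.Path x y} (h : WordEq S (word p) (word q)) :
    (rep k S).path p = (rep k S).path q := by
  have far : ∀ (s t : Bool) (i j : Fin n), 1 < |(i.val : ℤ) - j.val| →
      word p = [mv s i, mv t j] → word q = [mv t j, mv s i] →
      (rep k S).path p = (rep k S).path q := by
    intro s t i j hij hp hq
    obtain ⟨z, h1, h2, hp⟩ := rep_path_two p hp
    obtain ⟨z', h3, h4, hq⟩ := rep_path_two q hq
    rw [hp, hq]
    simp only [BS.arrowImage_mv]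
    rw [BS.f_mul_f_of_far hij h1 h2, BS.f_mul_f_of_far (by rwa [abs_sub_comm]) h3 h4]
  have back : ∀ (s : Bool) (i : Fin n), word p = [mv s i, mv (!s) i] → word q = [.U i] →
      (rep k S).path p = (rep k S).path q := by
    intro s i hp hq
    obtain ⟨z, h1, h2, hp⟩ := rep_path_two p hp
    obtain ⟨h3, hq⟩ := rep_path_one q hq
    rw [hp, hq]
    simp only [BS.arrowImage_mv]
    exact BS.f_back h2 h3
  generalize hp : word p = w at h
  generalize hq : word q = w' at h
  cases h with
  | r_r i j hij => exact far true true i j hij hp hq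
  | l_l i j hij => exact far false false i j hij hp hq
  | r_l_far i j hij => exact far true false i j hij hp hq
  | r_l i => exact back true i hp hq
  | l_r i => exact back false i hp hq
  | r_u i j =>
    obtain ⟨z, h1, h2, hp⟩ := rep_path_two p hp
    obtain ⟨z', h3, h4, hq⟩ := rep_path_two q hq
    rw [hp, hq]
    exact BS.arrowImage_U_comm (ℓ := .R i) j h1 h4 h3 h2
  | l_u i j =>
    obtain ⟨z, h1, h2, hp⟩ := rep_path_two p hp
    obtain ⟨z', h3, h4, hq⟩ := rep_path_two q hq
    rw [hp, hq]
    exact BS.arrowImage_U_comm (ℓ := .L i) j h1 h4 h3 h2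
  | u_u i j =>
    obtain ⟨z, h1, h2, hp⟩ := rep_path_two p hp
    obtain ⟨z', h3, h4, hq⟩ := rep_path_two q hq
    rw [hp, hq]
    exact BS.arrowImage_U_comm (ℓ := .U i) j h1 h4 h3 h2
  | c_central i a =>
    obtain ⟨z, h1, h2, hp⟩ := rep_path_two p hp
    obtain ⟨z', h3, h4, hq⟩ := rep_path_two q hq
    have h1 : x.state = z := h1
    have h4 : z' = y.state := h4
    rw [← h1] at hp h2
    rw [h4] at hq
    rw [hp, hq]
    have e : ∀ u v : IState n k, arrowImage u v (Label.C i) = BS.C k i * BS.idem S u :=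
      fun _ _ => rfl
    rw [e, e, BS.mul_assoc', BS.idem_mul_arrowImage h2, ← BS.mul_assoc', ← BS.C_comm, BS.mul_assoc',
      BS.arrowImage_mul_idem h2]

theorem rep_wordZero {x y : GVert k S} {p : Quiver.Path x y} (h : WordZero S (word p)) :
    (rep k S).path p = 0 := by
  generalize hp : word p = w at h
  cases h with
  | r_r i j hij =>
    obtain ⟨z, h1, h2, hp⟩ := rep_path_two p hp
    rw [hp]
    exact BS.f_mul_f_eq_zero (s := true) (i := i) (j := j) (Or.inl (Or.inl ⟨i, j, hij, rfl⟩)) h1 h2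
  | l_l i j hij =>
    obtain ⟨z, h1, h2, hp⟩ := rep_path_two p hp
    rw [hp]
    exact BS.f_mul_f_eq_zero (s := false) (i := j) (j := i) (Or.inl (Or.inr ⟨i, j, hij, rfl⟩)) h1 h2
  | c_c i =>
    obtain ⟨z, h1, h2, hp⟩ := rep_path_two p hp
    rw [hp, arrowImage, arrowImage, BS.C_comm, BS.mul_assoc', ← BS.mul_assoc' (BS.C k i),
      BS.C_mul_self, zero_mul, mul_zero]

/-- The homomorphism from the quiver algebra to `B(n,k,S)`. -/
def toBS (k : ℕ) (S : Finset (Fin n)) : GS k S →+* BS k S :=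
  quotLift _ ((rep k S).lift ((algebraMap (Poly n) (BS k S)).comp MvPolynomial.C)
    (fun c a => Algebra.commutes _ a)) (by
    rintro _ ((⟨x, y, p, q, h, rfl⟩ | ⟨x, y, p, h, rfl⟩) | ⟨x, i, h, h', rfl⟩)
    · rw [map_sub, QuiverRep.lift_ofPath, QuiverRep.lift_ofPath, rep_wordEq h, sub_self]
    · rw [QuiverRep.lift_ofPath, rep_wordZero h]
    · rw [QuiverRep.lift_ofPath, uLoop, QuiverRep.path_toPath]
      exact BS.smul_idem_eq_zero h h')

theorem toBS_ofPath {x y : GVert k S} (p : Quiver.Path x y) :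
    toBS k S (ofPath p) = (rep k S).path p := by
  rw [toBS, ofPath, quotLift_quotMap, QuiverRep.lift_ofPath]

theorem toBS_ofArrow {x y : GVert k S} (e : x ⟶ y) :
    toBS k S (ofArrow e) = arrowImage x.state y.state (arrowLabel e) := by
  rw [ofArrow, toBS_ofPath, QuiverRep.path_toPath]
  rfl

theorem toBS_idem (x : GVert k S) : toBS k S (idem x) = BS.idem S x.state := toBS_ofPath _

theorem toBS_U (i : Fin n) : toBS k S (U i) = BS.scalar k S (MvPolynomial.X i) := by
  rw [U, map_sum, ← mul_one (BS.scalar k S _), ← (BS.complete_idem k S).complete,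
    Finset.mul_sum]
  simp only [BS.scalar_mul]
  exact Finset.sum_congr rfl fun x _ => toBS_ofArrow (x := x) (y := x) ⟨.U i, rfl⟩

theorem toBS_sumC (i : S) : toBS k S (sumC k i) = BS.C k i := by
  rw [sumC, map_sum, ← mul_one (BS.C k i), ← (BS.complete_idem k S).complete, Finset.mul_sum]
  exact Finset.sum_congr rfl fun x _ => toBS_ofArrow (x := x) (y := x) ⟨.C i, rfl⟩

theorem toBS_uPoly (c : Poly n) : toBS k S (uPoly k S c) = BS.scalar k S c := by
  induction c using MvPolynomial.induction_on with
  | C a =>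
    fin_cases a
    · change toBS k S (uPoly k S (MvPolynomial.C 0)) = BS.scalar k S (MvPolynomial.C 0)
      simp
    · change toBS k S (uPoly k S (MvPolynomial.C 1)) = BS.scalar k S (MvPolynomial.C 1)
      simp
  | add p q hp hq => simp only [map_add, hp, hq]
  | mul_X p i hp => rw [map_mul, map_mul, hp, uPoly_X, toBS_U, map_mul]

theorem toBS_structHom (c : IState n k → Poly n) :
    toBS k S (structHom k S c) = BS.structHom k S c := by
  rw [structHom_apply, map_sum, BS.structHom_apply]
  refine Finset.sum_congr rfl fun x _ => ?_
  rw [map_mul, toBS_uPoly, toBS_idem]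
  rfl

theorem toBS_geodesic {x y : GVert k S} {a : GS k S} (h : Geodesic x y a) :
    toBS k S a = BS.f S x.state y.state := by
  induction h with
  | nil => rw [toBS_idem, BS.f_self]
  | @cons w y a s i h away _ ih =>
    have e : arrowLabel (mvArrow h) = mv s i := rfl
    rw [map_mul, ih, toBS_ofArrow, e, BS.arrowImage_mv, BS.f_mul_f_of_joins _ h, turn, if_pos away,
      one_smul]

end GS

end

section

/-! ### The inverse homomorphism -/

variable {n k : ℕ} {S : Finset (Fin n)}

namespace GS

/-- The central action of the `U_i` is what permits the universal properties of the exterior algebra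
and of the tensor product over `Poly n` to be used with values in the quiver algebra. -/
instance : Algebra (Poly n) (GS k S) := (uPoly k S).toAlgebra' uPoly_comm

theorem poly_smul (c : Poly n) (a : GS k S) : c • a = uPoly k S c * a := rfl

/-- The vertex of `Γ(n,k,S)` that is a given I-state. -/
def vert (S : Finset (Fin n)) (x : IState n k) : GVert k S := x

/-- The representation of the complete graph in the quiver algebra by shortest paths. -/
def geoRep (k : ℕ) (S : Finset (Fin n)) : QuiverRep (KVert n k) (GS k S) where
  vert x := idem (vert S x)
  arrow {x y} _ := geo (vert S x) (vert S y)
  complete := complete_idem (k := k) (S := S)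
  vert_mul_arrow _ := (geodesic_geo _ _).idem_mul
  arrow_mul_vert _ := (geodesic_geo _ _).mul_idem

/-- The homomorphism from `B_0(n,k)` to the quiver algebra. -/
def ofB0 (k : ℕ) (S : Finset (Fin n)) : B0 n k →+* GS k S :=
  quotLift _ ((geoRep k S).lift (uPoly k S) uPoly_comm) (by
    have edge : ∀ x y : KVert n k, (geoRep k S).lift (uPoly k S) uPoly_comm (kEdge x y) =
        geo (vert S x) (vert S y) := by
      intro x y
      rw [kEdge, QuiverRep.lift_ofPath, QuiverRep.path_toPath]
      rfl
    rintro _ (⟨x, rfl⟩ | ⟨x, y, z, rfl⟩)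
    · rw [map_sub, edge, geo_self, PathAlg.idem, QuiverRep.lift_ofPath]
      exact sub_self _
    · rw [map_sub, map_mul, QuiverRep.lift_smul, edge, edge, edge]
      exact sub_eq_zero.2 (geo_mul_geo (vert S x) (vert S y) (vert S z)))

theorem ofB0_f (x y : GVert k S) : ofB0 k S (B0.f x.state y.state) = geo x y := by
  rw [ofB0, B0.f, quotLift_quotMap]
  exact (QuiverRep.lift_ofPath _ _ _ _).trans ((geoRep k S).path_toPath _)

theorem ofB0_idem (x : GVert k S) : ofB0 k S (B0.idem x.state) = idem x := by
  rw [← B0.f_self, ofB0_f, geo_self]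

theorem ofB0_smul (c : Poly n) (a : B0 n k) : ofB0 k S (c • a) = uPoly k S c * ofB0 k S a := by
  obtain ⟨a, rfl⟩ := quotMap_surjective _ a
  exact QuiverRep.lift_smul _ _ _ c a

theorem geo_mul_geo_of_ne {x y y' z : GVert k S} (h : y ≠ y') : geo x y * geo y' z = 0 := by
  have h0 : (idem y : GS k S) * idem y' = 0 := complete_idem.ortho h
  rw [← (geodesic_geo x y).mul_idem, ← (geodesic_geo y' z).idem_mul, mul_assoc,
    ← mul_assoc (idem y), h0, zero_mul, mul_zero]

/-- Expanding both sums, terms that do not compose vanish. In the others a shortest path of length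
one is an arrow, so the product is the class of a two-arrow path that is zero by relation. -/
theorem ofB0_move_mul_move {s : Bool} {i j : Fin n}
    (hij : WordZero S [mv s i, mv s j]) :
    ofB0 k S (B0.move k s i * B0.move k s j) = 0 := by
  rw [map_mul, B0.move, B0.move, map_sum, Finset.sum_mul]
  refine Finset.sum_eq_zero fun x _ => ?_
  rw [map_sum, Finset.sum_mul]
  refine Finset.sum_eq_zero fun y _ => ?_
  split_ifs with h
  · rw [map_sum, Finset.mul_sum]
    refine Finset.sum_eq_zero fun y' _ => ?_
    rw [map_sum, Finset.mul_sum]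
    refine Finset.sum_eq_zero fun z _ => ?_
    split_ifs with h'
    · refine (congrArg₂ (· * ·) (ofB0_f (S := S) (vert S x) (vert S y))
        (ofB0_f (S := S) (vert S y') (vert S z))).trans ?_
      by_cases hy : vert S y = vert S y'
      · obtain rfl : y = y' := hy
        have h1 : (mv (S := S) s i).Joins (vert S x).state (vert S y).state := by
          cases s <;> exact h
        have h2 : (mv (S := S) s j).Joins (vert S y).state (vert S z).state := by
          cases s <;> exact h'
        change geo (vert S x) (vert S y) * geo (vert S y) (vert S z) = 0
        rw [geo_arrow h1, geo_arrow h2, ofArrow_mul_ofArrow]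
        exact quotMap_eq_zero (Or.inl (Or.inr ⟨vert S x, vert S z,
          (Quiver.Path.nil.cons (mvArrow h1)).cons (mvArrow h2), hij, rfl⟩))
      · exact geo_mul_geo_of_ne hy
    · rw [map_zero, mul_zero]
  · rw [map_zero, zero_mul]

/-- The homomorphism from `B(n,k)` to the quiver algebra. -/
def ofB (k : ℕ) (S : Finset (Fin n)) : B n k →ₐ[Poly n] GS k S :=
  { quotLift (bRel n k) (ofB0 k S) (by
      rintro _ ((⟨i, j, h, rfl⟩ | ⟨i, j, h, rfl⟩) | ⟨x, i, h, h', rfl⟩)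
      · exact ofB0_move_mul_move (s := true) (WordZero.r_r i j h)
      · exact ofB0_move_mul_move (s := false) (WordZero.l_l i j h)
      · rw [B0.idem_mul_U, ofB0_smul, uPoly_X]
        refine (congrArg (U i * ·) (ofB0_idem (S := S) x)).trans ?_
        refine (U_mul_idem i _).trans ?_
        exact quotMap_eq_zero (Or.inr ⟨x, i, h, h', rfl⟩)) with
    commutes' := fun c => by
      change ofB0 k S (algebraMap (Poly n) (B0 n k) c) = uPoly k S c
      rw [Algebra.algebraMap_eq_smul_one, ofB0_smul, map_one, mul_one] }

theorem ofB_quotMap (a : B0 n k) : ofB k S (quotMap (bRel n k) a) = ofB0 k S a := rfl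

theorem sum_sumC_sq (v : S → Poly n) :
    (∑ i : S, v i • (sumC k i : GS k S)) * (∑ i : S, v i • (sumC k i : GS k S)) = 0 := by
  -- Commuting square-zero elements have a square-zero sum in characteristic two. Centrality of the
  -- partial sums is carried along so that the two mixed terms can be identified.
  suffices h : ∀ s : Finset S, (∑ i ∈ s, v i • (sumC k i : GS k S)) *
      (∑ i ∈ s, v i • (sumC k i : GS k S)) = 0 ∧ ∀ a : GS k S,
        (∑ i ∈ s, v i • (sumC k i : GS k S)) * a = a * ∑ i ∈ s, v i • (sumC k i : GS k S) from
    (h _).1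
  intro s
  induction s using Finset.cons_induction with
  | empty => simp
  | cons i s hi ih =>
    obtain ⟨h1, h2⟩ := ih
    have h3 : v i • (sumC k i : GS k S) * v i • sumC k i = 0 := by
      rw [smul_mul_smul_comm, sumC_mul_self, smul_zero]
    have h4 : ∀ a : GS k S, v i • (sumC k i : GS k S) * a = a * v i • sumC k i := by
      intro a
      rw [smul_mul_assoc, mul_smul_comm, sumC_comm]
    rw [Finset.sum_cons]
    refine ⟨?_, fun a => by rw [add_mul, mul_add, h2, h4]⟩
    rw [mul_add, add_mul, add_mul, h1, h3, zero_add, add_zero, h2]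
    exact add_self _

/-- The homomorphism from the exterior algebra to the quiver algebra. -/
def ofExt (k : ℕ) (S : Finset (Fin n)) : Ext S →ₐ[Poly n] GS k S :=
  ExteriorAlgebra.lift (Poly n)
    ⟨∑ i : S, (LinearMap.proj i).smulRight (sumC k i : GS k S), fun v => by
      simp only [LinearMap.sum_apply, LinearMap.smulRight_apply, LinearMap.proj_apply]
      exact sum_sumC_sq v⟩

theorem ofExt_ι (v : S → Poly n) :
    ofExt k S (ExteriorAlgebra.ι (Poly n) v) = ∑ i : S, v i • (sumC k i : GS k S) := by
  rw [ofExt, ExteriorAlgebra.lift_ι_apply]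
  simp only [LinearMap.sum_apply, LinearMap.smulRight_apply, LinearMap.proj_apply]

theorem ofExt_extC (i : S) : ofExt k S (extC i) = sumC k i := by
  rw [extC, ofExt_ι, Finset.sum_eq_single i]
  · rw [Pi.single_eq_same, one_smul]
  · intro j _ hj
    rw [Pi.single_eq_of_ne hj, zero_smul]
  · simp

theorem ofExt_comm (e : Ext S) (a : GS k S) : ofExt k S e * a = a * ofExt k S e := by
  induction e using ExteriorAlgebra.induction generalizing a with
  | algebraMap r => rw [AlgHom.commutes]; exact Algebra.commutes r a
  | ι v =>
    rw [ofExt_ι, Finset.sum_mul, Finset.mul_sum]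
    exact Finset.sum_congr rfl fun i _ => by rw [smul_mul_assoc, mul_smul_comm, sumC_comm]
  | mul e e' h h' => rw [map_mul, mul_assoc, h', ← mul_assoc, h, mul_assoc]
  | add e e' h h' => rw [map_add, add_mul, mul_add, h, h']

/-- The homomorphism from `B(n,k,S)` to the quiver algebra. -/
def ofBS (k : ℕ) (S : Finset (Fin n)) : BS k S →ₐ[Poly n] GS k S :=
  Algebra.TensorProduct.lift (ofB k S) (ofExt k S) fun _ e => (ofExt_comm e _).symm

theorem ofBS_tmul (b : B n k) (e : Ext S) :
    ofBS k S (TensorProduct.tmul (Poly n) b e) = ofB k S b * ofExt k S e :=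
  Algebra.TensorProduct.lift_tmul _ _ _ b e

theorem ofBS_f (x y : GVert k S) : ofBS k S (BS.f S x.state y.state) = geo x y := by
  have h : BS.f S x.state y.state =
    TensorProduct.tmul (Poly n) (quotMap (bRel n k) (B0.f x.state y.state)) 1 := rfl
  rw [h, ofBS_tmul, map_one, mul_one, ofB_quotMap, ofB0_f]

theorem ofBS_idem (x : GVert k S) : ofBS k S (BS.idem S x.state) = idem x := by
  rw [← BS.f_self, ofBS_f, geo_self]

theorem ofBS_C (i : S) : ofBS k S (BS.C k i) = sumC k i := by
  rw [BS.C, ofBS_tmul, map_one, one_mul, ofExt_extC]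

theorem ofBS_arrowImage {x y : GVert k S} (e : x ⟶ y) :
    ofBS k S (arrowImage x.state y.state (arrowLabel e)) = ofArrow e := by
  obtain ⟨ℓ, h⟩ := e
  cases ℓ with
  | R i => exact (ofBS_f x y).trans (geo_arrow (s := true) h)
  | L i => exact (ofBS_f x y).trans (geo_arrow (s := false) h)
  | U i =>
    obtain rfl : x = y := h
    change ofBS k S ((MvPolynomial.X i : Poly n) • BS.idem S x.state) = _
    rw [map_smul, ofBS_idem, poly_smul, uPoly_X, U_mul_idem]
    rfl
  | C i =>
    obtain rfl : x = y := h
    change ofBS k S (BS.C k i * BS.idem S x.state) = _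
    rw [map_mul, ofBS_C, ofBS_idem, sumC_mul_idem]
    rfl

theorem ofBS_toBS (a : GS k S) : ofBS k S (toBS k S a) = a := by
  induction a using induction_on with
  | zero => rw [map_zero, map_zero]
  | add a b ha hb => rw [map_add, map_add, ha, hb]
  | path p =>
    induction p with
    | nil => rw [ofPath_nil, toBS_idem, ofBS_idem]
    | cons p e ih => rw [ofPath_cons, map_mul, map_mul, ih, toBS_ofArrow, ofBS_arrowImage]

theorem toBS_ofB0 (a : B0 n k) : toBS k S (ofB0 k S a) = BS.incl k S a := by
  obtain ⟨a, rfl⟩ := quotMap_surjective _ a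
  induction a using PathAlg.induction_on with
  | zero => simp only [map_zero]
  | add a b ha hb => simp only [map_add, ha, hb]
  | smul c a ha =>
    change toBS k S (ofB0 k S (c • quotMap _ a)) = BS.incl k S (c • quotMap _ a)
    rw [ofB0_smul, map_mul, ha, BS.incl_smul, toBS_uPoly, BS.scalar_mul]
  | @path x y p =>
    induction p with
    | nil =>
      change toBS k S (ofB0 k S (B0.idem x)) = BS.idem S x
      exact (congrArg _ (ofB0_idem (S := S) x)).trans (toBS_idem _)
    | @cons y z p e ih =>
      have h : (PathAlg.ofPath (p.cons e) : PathAlg (Poly n) (KVert n k)) =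
          PathAlg.ofPath p * kEdge y z := (PathAlg.ofPath_mul_ofPath p e.toPath).symm
      have h' : toBS k S (ofB0 k S (quotMap _ (kEdge y z))) =
          BS.incl k S (quotMap _ (kEdge y z)) := by
        refine (congrArg _ (ofB0_f (S := S) y z)).trans ?_
        exact toBS_geodesic (geodesic_geo _ _)
      rw [h, map_mul, map_mul, map_mul, map_mul, ih, h']

theorem toBS_ofExt (e : Ext S) :
    toBS k S (ofExt k S e) = TensorProduct.tmul (Poly n) (1 : B n k) e := by
  induction e using ExteriorAlgebra.induction with
  | algebraMap r =>
    rw [AlgHom.commutes]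
    refine (toBS_uPoly r).trans ?_
    rw [Algebra.algebraMap_eq_smul_one, ← TensorProduct.smul_tmul, ← Algebra.algebraMap_eq_smul_one]
    rfl
  | ι v =>
    rw [ofExt_ι, map_sum]
    -- Linear forms are expanded in the basis of the `C_i`, where the images are known.
    have h : v = ∑ i : S, v i • (Pi.single i 1 : S → Poly n) := by
      ext j : 1
      simp [Finset.sum_apply, Pi.single_apply]
    nth_rw 2 [h]
    rw [map_sum, TensorProduct.tmul_sum]
    refine Finset.sum_congr rfl fun i _ => ?_
    rw [poly_smul, map_mul, toBS_uPoly, toBS_sumC, BS.scalar_mul, map_smul,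
      TensorProduct.tmul_smul]
    rfl
  | mul e e' h h' =>
    rw [map_mul, map_mul, h, h', Algebra.TensorProduct.tmul_mul_tmul, one_mul]
  | add e e' h h' => rw [map_add, map_add, h, h', TensorProduct.tmul_add]

theorem toBS_ofBS (a : BS k S) : toBS k S (ofBS k S a) = a := by
  induction a using TensorProduct.induction_on with
  | zero => rw [map_zero, map_zero]
  | add a b ha hb => rw [map_add, map_add, ha, hb]
  | tmul b e =>
    obtain ⟨b, rfl⟩ := quotMap_surjective _ b
    rw [ofBS_tmul, map_mul, ofB_quotMap, toBS_ofB0, toBS_ofExt]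
    have h : BS.incl k S b = TensorProduct.tmul (Poly n) (quotMap (bRel n k) b) 1 := rfl
    rw [h, Algebra.TensorProduct.tmul_mul_tmul, one_mul, mul_one]

/-- The isomorphism from the quiver algebra to `B(n,k,S)`. -/
def equivBS (k : ℕ) (S : Finset (Fin n)) : GS k S ≃+* BS k S :=
  { toBS k S with
    invFun := ofBS k S
    left_inv := ofBS_toBS
    right_inv := toBS_ofBS }

end GS

end

section

variable {n k : ℕ} {S : Finset (Fin n)}

/-! ### The differentials -/

namespace BS

/-- Contraction with a linear form is an antiderivation; its sign disappears in characteristic two.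
-/
theorem extD_mul (a b : Ext S) : extD S (a * b) = extD S a * b + a * extD S b := by
  induction a using ExteriorAlgebra.induction generalizing b with
  | algebraMap r =>
    have h := CliffordAlgebra.contractLeft_algebraMap_mul (koszulForm S) r b
    have h' := CliffordAlgebra.contractLeft_algebraMap (Q := (0 : QuadraticForm (Poly n) (S → Poly n)))
      (koszulForm S) r
    change extD S (algebraMap (Poly n) (Ext S) r * b) = algebraMap (Poly n) (Ext S) r * extD S b at h
    change extD S (algebraMap (Poly n) (Ext S) r) = 0 at h'
    rw [h, h', zero_mul, zero_add]
  | ι v =>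
    have h := CliffordAlgebra.contractLeft_ι_mul (Q := (0 : QuadraticForm (Poly n) (S → Poly n)))
      (d := koszulForm S) v b
    have h' := CliffordAlgebra.contractLeft_ι (Q := (0 : QuadraticForm (Poly n) (S → Poly n)))
      (d := koszulForm S) v
    change extD S (ExteriorAlgebra.ι (Poly n) v * b) =
      koszulForm S v • b - ExteriorAlgebra.ι (Poly n) v * extD S b at h
    change extD S (ExteriorAlgebra.ι (Poly n) v) =
      algebraMap (Poly n) (Ext S) (koszulForm S v) at h'
    rw [h, h', ← Algebra.smul_def, sub_eq_add_neg, neg_eq_of_add_eq_zero_left (ext_add_self _)]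
  | mul a a' ha ha' =>
    rw [mul_assoc, ha, ha', ha, add_mul, mul_add, mul_assoc, mul_assoc, mul_assoc, add_assoc]
  | add a a' ha ha' =>
    rw [add_mul, map_add, ha, ha', map_add, add_mul, add_mul]
    abel

theorem extD_extC (i : S) :
    extD S (extC i) = algebraMap (Poly n) (Ext S) (MvPolynomial.X i.1) := by
  have h' := CliffordAlgebra.contractLeft_ι (Q := (0 : QuadraticForm (Poly n) (S → Poly n)))
      (d := koszulForm S) (Pi.single i 1)
  refine h'.trans (congrArg _ ?_)
  rw [koszulForm, LinearMap.sum_apply, Finset.sum_eq_single i]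
  · simp
  · intro j _ hj
    simp [Pi.single_eq_of_ne hj]
  · simp

theorem d_tmul (b : B n k) (e : Ext S) :
    d k S (TensorProduct.tmul (Poly n) b e) = TensorProduct.tmul (Poly n) b (extD S e) := rfl

theorem d_smul (c : Poly n) (a : BS k S) : d k S (c • a) = c • d k S a :=
  map_smul (LinearMap.lTensor (B n k) (extD S)) c a

theorem d_mul (a b : BS k S) : d k S (a * b) = d k S a * b + a * d k S b := by
  induction a using TensorProduct.induction_on with
  | zero => simp only [zero_mul, map_zero, add_zero]
  | add a a' ha ha' =>
    rw [add_mul, map_add, ha, ha', map_add, add_mul, add_mul]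
    abel
  | tmul a e =>
    induction b using TensorProduct.induction_on with
    | zero => simp only [mul_zero, map_zero, add_zero]
    | add b b' hb hb' =>
      rw [mul_add, map_add, hb, hb', map_add, mul_add, mul_add]
      abel
    | tmul b e' =>
      rw [d_tmul, d_tmul, Algebra.TensorProduct.tmul_mul_tmul,
        Algebra.TensorProduct.tmul_mul_tmul, Algebra.TensorProduct.tmul_mul_tmul, d_tmul,
        extD_mul, TensorProduct.tmul_add]

theorem d_incl (a : B0 n k) : d k S (incl k S a) = 0 := by
  have h : extD S 1 = 0 :=
    CliffordAlgebra.contractLeft_one (Q := (0 : QuadraticForm (Poly n) (S → Poly n)))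
      (d := koszulForm S)
  have e : incl k S a = TensorProduct.tmul (Poly n) (quotMap (bRel n k) a) 1 := rfl
  rw [e, d_tmul, h, TensorProduct.tmul_zero]

theorem d_C_mul_idem (i : S) (x : IState n k) :
    d k S (C k i * idem S x) = (MvPolynomial.X i.1 : Poly n) • idem S x := by
  have h : d k S (idem S x) = 0 := d_incl _
  have e : TensorProduct.tmul (Poly n) (1 : B n k)
      (algebraMap (Poly n) (Ext S) (MvPolynomial.X i.1)) = scalar k S (MvPolynomial.X i.1) := by
    rw [Algebra.algebraMap_eq_smul_one, ← TensorProduct.smul_tmul,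
      ← Algebra.algebraMap_eq_smul_one]
    rfl
  rw [d_mul, h, mul_zero, add_zero, C, d_tmul, extD_extC, e, scalar_mul]

end BS

namespace GS

theorem toBS_d_ofArrow {x y : GVert k S} (e : x ⟶ y) :
    toBS k S (d k S (ofArrow e)) = BS.d k S (toBS k S (ofArrow e)) := by
  rw [d_ofArrow, toBS_ofArrow]
  obtain ⟨ℓ, h⟩ := e
  cases ℓ with
  | R i =>
    refine (congrArg _ (map_zero (quotMap (gRel k S)))).trans ((map_zero _).trans ?_)
    exact (BS.d_incl _).symm
  | L i =>
    refine (congrArg _ (map_zero (quotMap (gRel k S)))).trans ((map_zero _).trans ?_)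
    exact (BS.d_incl _).symm
  | U i =>
    refine (congrArg _ (map_zero (quotMap (gRel k S)))).trans ((map_zero _).trans ?_)
    refine ((BS.d_smul _ _).trans ?_).symm
    exact (congrArg _ (BS.d_incl _)).trans (smul_zero _)
  | C i =>
    refine Eq.trans ?_ (BS.d_C_mul_idem i x.state).symm
    exact toBS_ofArrow (x := x) (y := x) ⟨.U i.1, rfl⟩

/-- Both sides obey the Leibniz rule along `toBS`, so agreement on idempotents and arrows suffices.
-/
theorem toBS_d (a : GS k S) : toBS k S (d k S a) = BS.d k S (toBS k S a) := by
  induction a using induction_on with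
  | zero => simp only [map_zero]
  | add a b ha hb => simp only [map_add, ha, hb]
  | path p =>
    induction p with
    | nil =>
      rw [ofPath_nil, d_idem, toBS_idem, map_zero]
      exact (BS.d_incl _).symm
    | cons p e ih =>
      rw [ofPath_cons, d_mul, map_mul, BS.d_mul, map_add, map_mul, map_mul, ih, toBS_d_ofArrow]

end GS

/-! ### The gradings -/

/-- The number of `C`-factors and twice the Alexander multi-degree of a label. -/
def Label.preDeg : Label S → ℤ × (Fin n → ℤ)
  | .R i => (0, Pi.single i 1)
  | .L i => (0, Pi.single i 1)
  | .U i => (0, Pi.single i 2)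
  | .C i => (1, Pi.single i.1 2)

theorem Label.preDeg_mv (s : Bool) (i : Fin n) :
    Label.preDeg (mv (S := S) s i) = (0, Pi.single i 1) := by
  cases s <;> rfl

/-- The passage from the number of `C`-factors and twice the Alexander multi-degree to the Maslov
degree and the Alexander multi-degree. -/
def degHom (S : Finset (Fin n)) : ℤ × (Fin n → ℤ) →+ ℤ × (Fin n → HalfInt) where
  toFun g := (g.1 - ∑ i ∈ S, g.2 i, fun i => halves (g.2 i))
  map_zero' := by
    simp only [Prod.fst_zero, Prod.snd_zero, Pi.zero_apply, Finset.sum_const_zero, sub_zero, halves,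
      zero_smul]
    rfl
  map_add' g h := by
    simp only [Prod.fst_add, Prod.snd_add, Pi.add_apply, Finset.sum_add_distrib, halves, add_smul]
    refine Prod.ext ?_ rfl
    simp only [Prod.fst_add]
    ring

/-- The Maslov degree is determined by the number of `C`-factors and the multi-degree. It is
therefore enough to compare the two algebras in the integral grading `Label.preDeg` and then to
apply homomorphisms. -/
theorem Label.deg_eq (ℓ : Label S) : ℓ.deg = degHom S ℓ.preDeg := by
  have hs : ∀ (i : Fin n) (m : ℤ), (fun j => halves ((Pi.single i m : Fin n → ℤ) j)) =
      Pi.single i (halves m) := by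
    intro i m
    funext j
    by_cases h : j = i
    · subst h; simp
    · simp [Pi.single_eq_of_ne h, halves]
  have hm : ∀ (i : Fin n) (m : ℤ), ∑ j ∈ S, (Pi.single i m : Fin n → ℤ) j =
      if i ∈ S then m else 0 := by
    intro i m
    simp [Pi.single_apply]
  cases ℓ <;> refine Prod.ext ?_ (hs _ _).symm <;>
    simp [Label.deg, Label.maslov, Label.preDeg, degHom, hm] <;>
    split_ifs <;> rfl

namespace BS

/-- The number of `C`-factors and twice the Alexander multi-degree of an additive generator. -/
def genPreDeg (l : List S) (r : Fin n → ℕ) (x y : IState n k) : ℤ × (Fin n → ℤ) :=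
  (l.length, genWeight S l r x y)

theorem genDeg_eq (l : List S) (r : Fin n → ℕ) (x y : IState n k) :
    genDeg S l r x y = degHom S (genPreDeg l r x y) := rfl

theorem gen_nil_zero (x y : IState n k) : gen S [] 0 x y = f S x y := by
  simp only [gen, List.map_nil, List.prod_nil, Pi.zero_apply, pow_zero, Finset.prod_const_one,
    one_smul]
  exact one_mul (f S x y)

theorem smul_gen (l : List S) (r : Fin n → ℕ) (i : Fin n) (x y : IState n k) :
    (MvPolynomial.X i : Poly n) • gen S l r x y = gen S l (r + Pi.single i 1) x y := by
  have h : (∏ j, MvPolynomial.X j ^ (r + Pi.single i 1 : Fin n → ℕ) j : Poly n) =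
      MvPolynomial.X i * ∏ j, MvPolynomial.X j ^ r j := by
    simp only [Pi.add_apply, pow_add, Finset.prod_mul_distrib, Pi.single_apply, pow_ite, pow_one,
      pow_zero, Finset.prod_ite_eq', Finset.mem_univ, if_true]
    ring
  rw [gen, gen, h, ← mul_smul_comm, smul_smul]

theorem C_mul_gen (i : S) (l : List S) (r : Fin n → ℕ) (x y : IState n k) :
    C k i * gen S l r x y = gen S (i :: l) r x y := by
  rw [gen, gen, List.map_cons, List.prod_cons, mul_assoc']

theorem gen_mul_f {s : Bool} {i : Fin n} (l : List S) (r : Fin n → ℕ) (x : IState n k)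
    {w y : IState n k} (h : (mv (S := S) s i).Joins w y) :
    gen S l r x w * f S w y = turn s i x y • gen S l r x y := by
  rw [gen, gen, mul_assoc', smul_mul_assoc, f_mul_f_of_joins x h, smul_comm, mul_smul_comm]

theorem gen_mul_idem (l : List S) (r : Fin n → ℕ) (x y : IState n k) :
    gen S l r x y * idem S y = gen S l r x y := by
  rw [gen, mul_assoc', smul_mul_assoc, f_mul_idem]

end BS

theorem absWeight_eq (x y : IState n k) (i : Fin n) : absWeight x y i = |wt x y (i.val + 1)| := by
  rw [absWeight, relWeight_eq]

theorem absWeight_of_joins {s : Bool} {i : Fin n} {w y : IState n k}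
    (h : (mv (S := S) s i).Joins w y) (x : IState n k) :
    absWeight x y = absWeight x w +
      Pi.single i (if 0 < sgn s * wt x y (i.val + 1) then 1 else -1) := by
  funext j
  rw [Pi.add_apply, absWeight_eq, absWeight_eq, wt_of_joins h x (j.val + 1)]
  by_cases hj : j = i
  · subst hj
    rw [Pi.single_eq_same, wt_of_joins h x]
    simp only [if_true, Int.abs_eq_natAbs]
    rcases sgn_eq s with e | e <;> rw [e] <;> split_ifs <;> omega
  · rw [Pi.single_eq_of_ne hj, if_neg, add_zero, add_zero]
    · intro h
      exact hj (Fin.ext (by simpa using h))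

namespace GS

/-- Every path goes to a single additive generator, not only to a combination of them, as each
further arrow multiplies a generator to another one. Degrees match arrow by arrow. -/
theorem exists_gen {x y : GVert k S} (p : Quiver.Path x y) : ∃ (l : List S) (r : Fin n → ℕ),
    BS.genPreDeg l r x.state y.state = pathDeg Label.preDeg p ∧
      toBS k S (ofPath p) = BS.gen S l r x.state y.state := by
  induction p with
  | nil =>
    refine ⟨[], 0, Prod.ext rfl (funext fun i => ?_), ?_⟩
    · simp [BS.genPreDeg, BS.genWeight, absWeight_eq, wt_self, pathDeg_nil]
    · rw [ofPath_nil, toBS_idem, BS.gen_nil_zero, BS.f_self]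
  | @cons w y p e ih =>
    obtain ⟨l, r, hd, hg⟩ := ih
    rw [ofPath_cons, map_mul, hg, pathDeg_cons, ← hd, toBS_ofArrow]
    have hmv : ∀ (s : Bool) (i : Fin n), arrowLabel e = mv s i → ∃ (l' : List S) (r' : Fin n → ℕ),
        BS.genPreDeg l' r' x.state y.state = BS.genPreDeg l r x.state w.state +
          (arrowLabel e).preDeg ∧ BS.gen S l r x.state w.state *
            arrowImage w.state y.state (arrowLabel e) = BS.gen S l' r' x.state y.state := by
      intro s i he
      have hj : (mv (S := S) s i).Joins w.state y.state := he ▸ e.2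
      have ha := absWeight_of_joins hj x.state
      rw [he, BS.arrowImage_mv, BS.gen_mul_f l r x.state hj, Label.preDeg_mv, turn]
      split_ifs at ha ⊢ with away
      · refine ⟨l, r, Prod.ext (add_zero _).symm (funext fun j => ?_), one_smul _ _⟩
        simp only [BS.genPreDeg, BS.genWeight, ha, Prod.snd_add, Pi.add_apply]
        ring
      -- A move back towards `x` lowers `|v|_i` by one and creates a factor `U_i`, which counts
      -- twice in the doubled degree; the net change is again one.
      · refine ⟨l, r + Pi.single i 1, Prod.ext (add_zero _).symm (funext fun j => ?_),
          BS.smul_gen l r i _ _⟩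
        simp only [BS.genPreDeg, BS.genWeight, ha, Prod.snd_add, Pi.add_apply]
        by_cases hj : j = i
        · subst hj
          simp only [Pi.single_eq_same]
          push_cast
          ring
        · simp [Pi.single_eq_of_ne hj]
    obtain ⟨ℓ, h⟩ := e
    cases ℓ with
    | R i => exact hmv true i rfl
    | L i => exact hmv false i rfl
    | U i =>
      obtain rfl : w = y := h
      refine ⟨l, r + Pi.single i 1, Prod.ext (add_zero _).symm (funext fun j => ?_), ?_⟩
      · simp only [BS.genPreDeg, BS.genWeight, Prod.snd_add, Pi.add_apply, arrowLabel,
          Label.preDeg]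
        by_cases hj : j = i
        · subst hj
          simp only [Pi.single_eq_same]
          push_cast
          ring
        · simp [Pi.single_eq_of_ne hj]
      · change BS.gen S l r x.state w.state * ((MvPolynomial.X i : Poly n) • BS.idem S w.state) = _
        rw [mul_smul_comm, BS.gen_mul_idem, BS.smul_gen]
    | C i =>
      obtain rfl : w = y := h
      refine ⟨i :: l, r, Prod.ext ?_ (funext fun j => ?_), ?_⟩
      · simp [BS.genPreDeg, arrowLabel, Label.preDeg]
      · simp only [BS.genPreDeg, BS.genWeight, Prod.snd_add, Pi.add_apply, arrowLabel,
          Label.preDeg, List.map_cons, List.count_cons]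
        by_cases hj : j = i.1
        · subst hj
          simp only [Pi.single_eq_same, beq_self_eq_true, if_true]
          push_cast
          ring
        · have : ¬(i.1 = j) := fun h => hj h.symm
          simp [this]
      · change BS.gen S l r x.state w.state * (BS.C k i * BS.idem S w.state) = _
        rw [← BS.mul_assoc', ← BS.C_comm, BS.mul_assoc', BS.gen_mul_idem, BS.C_mul_gen]

theorem sumC_mem_part {G : Type} [AddCommGroup G] (δ : Label S → G) (i : S) :
    sumC k i ∈ part k δ (δ (.C i)) :=
  sum_mem fun x _ => ofArrow_mem_part δ (x := x) (y := x) ⟨.C i, rfl⟩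

theorem U_mem_part {G : Type} [AddCommGroup G] (δ : Label S → G) (i : Fin n) :
    U i ∈ part k δ (δ (.U i)) :=
  sum_mem fun x _ => ofArrow_mem_part δ (x := x) (y := x) ⟨.U i, rfl⟩

theorem Geodesic.mem_part {x y : GVert k S} {a : GS k S} (h : Geodesic x y a) :
    a ∈ part k Label.preDeg (0, absWeight x.state y.state) := by
  induction h with
  | nil =>
    have : absWeight x.state x.state = 0 := funext fun i => by simp [absWeight_eq, wt_self]
    rw [this]
    exact idem_mem_part _ x
  | @cons w y a s i h away _ ih =>
    have e := mul_mem_part Label.preDeg ih (ofArrow_mem_part Label.preDeg (mvArrow h))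
    have h' : arrowLabel (mvArrow h) = mv s i := rfl
    rw [h', Label.preDeg_mv] at e
    rw [absWeight_of_joins h x.state, if_pos away]
    exact e

theorem uPoly_prod_mem_part (r : Fin n → ℕ) :
    uPoly k S (∏ i, MvPolynomial.X i ^ r i) ∈
      part k Label.preDeg (0, fun i => 2 * (r i : ℤ)) := by
  have pow : ∀ (i : Fin n) (m : ℕ), (U i : GS k S) ^ m ∈
      part k Label.preDeg (m • ((0, Pi.single i 2) : ℤ × (Fin n → ℤ))) := by
    intro i m
    induction m with
    | zero => rw [pow_zero, zero_smul]; exact one_mem_part _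
    | succ m ih => rw [pow_succ, succ_nsmul]; exact mul_mem_part _ ih (U_mem_part _ i)
  have prod : ∀ s : Finset (Fin n), uPoly k S (∏ i ∈ s, MvPolynomial.X i ^ r i) ∈
      part k Label.preDeg (∑ i ∈ s, r i • ((0, Pi.single i 2) : ℤ × (Fin n → ℤ))) := by
    intro s
    induction s using Finset.cons_induction with
    | empty => rw [Finset.prod_empty, map_one, Finset.sum_empty]; exact one_mem_part _
    | cons i s hi ih =>
      rw [Finset.prod_cons, Finset.sum_cons, map_mul, map_pow, uPoly_X]
      exact mul_mem_part _ (pow i _) ih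
  convert prod Finset.univ using 2
  refine Prod.ext ?_ (funext fun j => ?_)
  · simp [Prod.fst_sum]
  · simp [Prod.snd_sum, Finset.sum_apply, Pi.single_apply, mul_comm]

theorem prod_sumC_mem_part (l : List S) : (l.map (sumC k)).prod ∈
    part k Label.preDeg ((l.length : ℤ), fun i => 2 * ((l.map Subtype.val).count i : ℤ)) := by
  induction l with
  | nil => exact one_mem_part _
  | cons i l ih =>
    rw [List.map_cons, List.map_cons, List.prod_cons]
    convert mul_mem_part Label.preDeg (sumC_mem_part Label.preDeg i) ih using 2
    refine Prod.ext ?_ (funext fun j => ?_)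
    · simp [Label.preDeg, add_comm]
    · simp only [Label.preDeg, List.count_cons, Prod.snd_add, Pi.add_apply]
      by_cases hj : j = i.1
      · subst hj
        simp only [Pi.single_eq_same, beq_self_eq_true, if_true]
        push_cast
        ring
      · have : ¬(i.1 = j) := fun h => hj h.symm
        simp [this]

theorem ofBS_prod_C (l : List S) :
    ofBS k S (l.map (BS.C k)).prod = (l.map (sumC k)).prod := by
  induction l with
  | nil => exact (ofBS_tmul 1 1).trans (by rw [map_one, map_one, mul_one]; rfl)
  | cons i l ih => rw [List.map_cons, List.map_cons, List.prod_cons, List.prod_cons, map_mul,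
      ofBS_C, ih]

/-- The three factors of a generator come from loops `C_i`, loops `U_i` and a shortest path, each of
which is homogeneous; the degree of a shortest path is exactly `|v|(x,y)`, since none of its moves
leads back. -/
theorem ofBS_gen_mem_part (l : List S) (r : Fin n → ℕ) (x y : GVert k S) :
    ofBS k S (BS.gen S l r x.state y.state) ∈
      part k Label.preDeg (BS.genPreDeg l r x.state y.state) := by
  have h : ofBS k S (BS.gen S l r x.state y.state) = (l.map (sumC k)).prod *
      (uPoly k S (∏ i, MvPolynomial.X i ^ r i) * geo x y) := by
    rw [BS.gen, map_mul, map_smul, ofBS_f, poly_smul, ofBS_prod_C]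
  rw [h]
  convert mul_mem_part _ (prod_sumC_mem_part l) (mul_mem_part _ (uPoly_prod_mem_part r)
    (geodesic_geo x y).mem_part) using 2
  refine Prod.ext ?_ (funext fun j => ?_)
  · simp [BS.genPreDeg]
  · simp [BS.genPreDeg, BS.genWeight, add_assoc]

theorem pathDeg_map {G H : Type} [AddCommGroup G] [AddCommGroup H] (δ : Label S → G) (τ : G →+ H)
    {x y : GVert k S} (p : Quiver.Path x y) :
    pathDeg (fun ℓ => τ (δ ℓ)) p = τ (pathDeg δ p) := by
  rw [pathDeg, pathDeg, map_list_sum, List.map_map]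
  rfl

theorem mem_part_map {G H : Type} [AddCommGroup G] [AddCommGroup H] (δ : Label S → G) (τ : G →+ H)
    {g : G} {a : GS k S} (h : a ∈ part k δ g) : a ∈ part k (fun ℓ => τ (δ ℓ)) (τ g) := by
  refine AddSubgroup.closure_mono ?_ h
  rintro _ ⟨x, y, p, rfl, rfl⟩
  exact ⟨x, y, p, pathDeg_map δ τ p, rfl⟩

/-- It suffices to compare spanning sets, in both directions. The homomorphism `σ` is arbitrary, so
that the multi-grading and the single Alexander grading are treated at once. -/
theorem map_part {G : Type} [AddCommGroup G] (σ : ℤ × (Fin n → HalfInt) →+ G) (g : G) :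
    (part k (fun ℓ : Label S => σ ℓ.deg) g).map (equivBS k S : GS k S →+ BS k S) =
      BS.part k S σ g := by
  have hσ : (fun ℓ : Label S => σ ℓ.deg) = fun ℓ => (σ.comp (degHom S)) ℓ.preDeg :=
    funext fun ℓ => congrArg σ ℓ.deg_eq
  apply le_antisymm
  · rw [part, AddMonoidHom.map_closure]
    refine AddSubgroup.closure_mono ?_
    rintro _ ⟨_, ⟨x, y, p, rfl, rfl⟩, rfl⟩
    obtain ⟨l, r, hd, hg⟩ := exists_gen p
    refine ⟨l, r, x.state, y.state, ?_, hg⟩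
    rw [hσ, pathDeg_map, ← hd]
    rfl
  · refine (AddSubgroup.closure_le _).2 ?_
    rintro _ ⟨l, r, x, y, rfl, rfl⟩
    refine ⟨ofBS k S (BS.gen S l r x y), ?_, toBS_ofBS _⟩
    rw [hσ]
    have h := mem_part_map Label.preDeg (σ.comp (degHom S))
      (ofBS_gen_mem_part (k := k) l r (vert S x) (vert S y))
    rw [AddMonoidHom.comp_apply, ← BS.genDeg_eq] at h
    exact h

end GS

/-! ### Transport along an isomorphism -/

/-- A differential graded algebra structure can be carried over along a ring isomorphism. -/
theorem IsDGAlgebra.of_equiv {I A B G : Type} [CommRing I] [Ring A] [Ring B] [AddCommGroup G]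
    {η : I →+* A} {d : A →+ A} {𝒜 : G → AddSubgroup A} {lam : G} (h : IsDGAlgebra η d 𝒜 lam)
    {η' : I →+* B} {d' : B →+ B} {ℬ : G → AddSubgroup B} (F : A ≃+* B)
    (hη : ∀ c, F (η c) = η' c) (hd : ∀ a, F (d a) = d' (F a))
    (hF : ∀ g, (𝒜 g).map (F : A →+ B) = ℬ g) : IsDGAlgebra η' d' ℬ lam := by
  have mem : ∀ g a, a ∈ 𝒜 g → F a ∈ ℬ g := fun g a ha => hF g ▸ ⟨a, ha, rfl⟩
  have mem' : ∀ g b, b ∈ ℬ g → ∃ a ∈ 𝒜 g, F a = b := by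
    intro g b hb
    rw [← hF g] at hb
    exact hb
  refine ⟨?_, ?_, ?_, ?_, ?_, ?_, ?_, ?_⟩
  · intro c b
    obtain ⟨a, rfl⟩ := F.surjective b
    rw [← hη, ← map_mul, ← hd, h.map_smul_left, map_mul, hd]
  · intro c b
    obtain ⟨a, rfl⟩ := F.surjective b
    rw [← hη, ← map_mul, ← hd, h.map_smul_right, map_mul, hd]
  · intro b
    obtain ⟨a, rfl⟩ := F.surjective b
    rw [← hd, ← hd, h.sq_zero, map_zero]
  · intro b b'
    obtain ⟨a, rfl⟩ := F.surjective b
    obtain ⟨a', rfl⟩ := F.surjective b'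
    rw [← map_mul, ← hd, h.leibniz, map_add, map_mul, map_mul, hd, hd]
  · exact map_one F ▸ mem 0 1 h.one_mem
  · intro g g' b b' hb hb'
    obtain ⟨a, ha, rfl⟩ := mem' g b hb
    obtain ⟨a', ha', rfl⟩ := mem' g' b' hb'
    exact map_mul F a a' ▸ mem _ _ (h.mul_mem _ _ _ _ ha ha')
  · classical
    have hi : DirectSum.IsInternal 𝒜 := by convert h.internal
    let e := AddEquiv.ofBijective (DirectSum.coeAddMonoidHom 𝒜) hi
    have he : ∀ g a (ha : a ∈ 𝒜 g), e.symm a = DirectSum.of (fun g => 𝒜 g) g ⟨a, ha⟩ := by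
      intro g a ha
      rw [AddEquiv.symm_apply_eq]
      exact (DirectSum.coeAddMonoidHom_of 𝒜 g ⟨a, ha⟩).symm
    -- The projections of `A` to its homogeneous parts, conjugated by `F`.
    let π : G → B →+ B := fun g => (F : A →+ B).comp ((𝒜 g).subtype.comp
      ((DFinsupp.evalAddMonoidHom g).comp (e.symm.toAddMonoidHom.comp (F.symm : B →+ A))))
    have hπ : ∀ g b, π g b = F ((e.symm (F.symm b)) g : A) := fun _ _ => rfl
    have key : DirectSum.IsInternal ℬ := by
      refine isInternal_of_projections ℬ π ?_ ?_ ?_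
      · intro g b hb
        obtain ⟨a, ha, rfl⟩ := mem' g b hb
        rw [hπ, F.symm_apply_apply, he g a ha, DirectSum.of_eq_same]
      · intro g g' b hb hne
        obtain ⟨a, ha, rfl⟩ := mem' g b hb
        rw [hπ, F.symm_apply_apply, he g a ha, DirectSum.of_eq_of_ne _ _ _ hne]
        exact map_zero F
      · rw [eq_top_iff]
        rintro b -
        obtain ⟨a, rfl⟩ := F.surjective b
        obtain ⟨x, rfl⟩ := hi.2 a
        induction x using DirectSum.induction_on with
        | zero => rw [map_zero, map_zero]; exact zero_mem _
        | of g a =>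
          rw [DirectSum.coeAddMonoidHom_of]
          exact AddSubgroup.mem_iSup_of_mem g (mem g a a.2)
        | add x y hx hy => rw [map_add, map_add]; exact add_mem hx hy
    convert key
  · intro g b hb
    obtain ⟨a, ha, rfl⟩ := mem' g b hb
    rw [← hd]
    exact mem _ _ (h.d_mem g a ha)

end

end

end OSz

/-! ### The isomorphism theorem -/

theorem theorem1p2 (n k : ℕ) (S : Finset (Fin n)) :
    -- `B(n,k,S)` is a dg algebra over `F₂[U_1, …, U_n]^{V(n,k)}`, for either grading
    OSz.IsDGAlgebra (OSz.BS.structHom k S) (OSz.BS.d k S) (OSz.BS.part k S id) (1, 0) ∧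
    OSz.IsDGAlgebra (OSz.BS.structHom k S) (OSz.BS.d k S)
      (OSz.BS.part k S (OSz.collapse S)) (1, 0) ∧
    -- so is the quiver algebra, which has the unrefined multi-grading in addition
    OSz.IsDGAlgebra (OSz.GS.structHom k S) (OSz.GS.d k S)
      (OSz.GS.part k (OSz.Label.deg (S := S))) (1, 0) ∧
    OSz.IsDGAlgebra (OSz.GS.structHom k S) (OSz.GS.d k S)
      (OSz.GS.part k fun ℓ : OSz.Label S => OSz.collapse S ℓ.deg) (1, 0) ∧
    OSz.IsDGAlgebra (OSz.GS.structHom k S) (OSz.GS.d k S)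
      (OSz.GS.part k (OSz.Label.unrefinedDeg (S := S))) (1, 0) ∧
    -- the two are isomorphic
    ∃ F : OSz.GS k S ≃+* OSz.BS k S,
      (∀ c, F (OSz.GS.structHom k S c) = OSz.BS.structHom k S c) ∧
      (∀ a, F (OSz.GS.d k S a) = OSz.BS.d k S (F a)) ∧
      (∀ g, (OSz.GS.part k (OSz.Label.deg (S := S)) g).map (F : OSz.GS k S →+ OSz.BS k S) =
        OSz.BS.part k S id g) ∧
      (∀ g, (OSz.GS.part k (fun ℓ : OSz.Label S => OSz.collapse S ℓ.deg) g).map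
          (F : OSz.GS k S →+ OSz.BS k S) = OSz.BS.part k S (OSz.collapse S) g) ∧
      (∀ (x y : OSz.GVert k S) (e : x ⟶ y),
        F (OSz.GS.ofArrow e) = OSz.arrowImage x.state y.state (OSz.arrowLabel e)) := by
  have g1 := OSz.GS.isDGAlgebra k (OSz.Label.homogeneous_deg (S := S)) (1, 0) OSz.Label.deg_U
  have g2 := OSz.GS.isDGAlgebra k
    ((OSz.Label.homogeneous_deg (S := S)).comp (OSz.collapseHom S)) (1, 0) fun i => by
      rw [OSz.Label.deg_U, map_sub, OSz.collapseHom_lam]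
  have g3 := OSz.GS.isDGAlgebra k (OSz.Label.homogeneous_unrefinedDeg (S := S)) (1, 0)
    OSz.Label.unrefinedDeg_U
  -- The identity gives the multi-grading, and the homomorphism `collapseHom` gives the single
  -- Alexander grading.
  have m1 := OSz.GS.map_part (k := k) (S := S) (AddMonoidHom.id _)
  have m2 := OSz.GS.map_part (k := k) (S := S) (OSz.collapseHom S)
  exact ⟨g1.of_equiv (OSz.GS.equivBS k S) OSz.GS.toBS_structHom OSz.GS.toBS_d m1,
    g2.of_equiv (OSz.GS.equivBS k S) OSz.GS.toBS_structHom OSz.GS.toBS_d m2, g1, g2, g3,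
    OSz.GS.equivBS k S, OSz.GS.toBS_structHom, OSz.GS.toBS_d, m1, m2,
    fun _ _ => OSz.GS.toBS_ofArrow⟩
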